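/- **Theorem (Integrity of Unlearning).** Fix the number $N$ of devices, the dimension $d$, and for each round $t$ the set $U_t$ of participating devices, with $U_t = U_{nor}\sqcup U_{unl}$ (normal devices and devices requesting unlearning). Consider the following protocol, with security parameter $\kappa$; all its algorithms are probabilistic polynomial time (PPT). *Setup.* A group generator outputs a cyclic group $G$ of prime order $q$ with generator $g$ and efficient multiplication, whose elements have encodings of length polynomial in $\kappa$; $g_1,\dots,g_d\in G$ are independent and uniform, and $\mathrm{Hash}(m)=\prod_{k} g_k^{m[k]}$ for $m\in\mathbb F_q^d$. A commitment scheme outputs a trapdoor and public parameters $pp$; the encoded elements of $G$ are messages of the scheme, and $(x,r)$ opens $m$ if $m=\mathrm{Com}(pp,x,r)$. A Paillier key is generated from numbers $p',q',g'$ sampled in polynomial time, with $n=p'q'$. Except with negligible probability, $p',q'$ are distinct primes with $\gcd(p'q',(p'-1)(q'-1))=1$, $g'\in\mathbb Z_{n^2}^*$, the number $L(g'^{\lambda}\bmod n^2)$ is invertible modulo $n$, where $\lambda=\mathrm{lcm}(p'-1,q'-1)$ and $L(x)=(x-1)/n$, and $Nq<n$. Elements of $\mathbb F_q$ are encrypted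 through their representatives of least absolute value modulo $q$, and a plaintext in $\mathbb Z_n$ is decoded to $\mathbb F_q$ through its representative of least absolute value modulo $n$. The devices hold the secret key, and private datasets produced by a PPT algorithm. The server receives all public parameters and chooses an initial model. *Round $t$.* Each device $i$ trains locally (by any PPT algorithm of its dataset, the initial model and the previously decrypted results), giving $v_t^{(i)}\in\mathbb F_q^d$; if $i\in U_t$, it adds $v_t^{(i)}$ to its historical contribution $cv_i$. Put $c_i=v_t^{(i)}$, $f_i=1$ for $i\in U_{nor}$ and $c_i=cv_i$, $f_i=-1$ for $i\in U_{unl}$. Device $i\in U_t$ computes $h_i=\mathrm{Hash}(c_i)$ and $m_i=\mathrm{Com}(pp,h_i,r_i)$ with uniformly random $r_i$, and sends $m_i$, $f_i$ and the Paillier encryption $\llbracket c_i\rrbracket$. The $m_i$ and $f_i$ reach all devices unchanged. Let $\llbracket a\rrbracket=\bigoplus_{i\in U_{nor}}\llbracket c_i\rrbracket\ominus\bigoplus_{j\in U_{unl}}\llbracket c_j\rrbracket$ be the honest result and $a\in\mathbb F_q^d$ its decryption. The server broadcasts some $\llbracket a'\rrbracket$, which the devices decrypt to $a'\in\mathbb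 F_q^d$; then the devices send $(h_i,r_i)$ to the server, which passes on openings $(h_i',r_i')$ of its choice. A device $i\in U_{unl}$ accepts if, for every $j\in U_t\setminus\{i\}$, $h_j'$ encodes an element of $G$ and $(h_j',r_j')$ opens $m_j$, and if $\mathrm{Hash}(a')=\prod_{j\in U_t}h_j'^{f_j}$, where $h_i'=h_i$ is its own hash value; otherwise it outputs $\perp$. Assume that the discrete logarithm problem is hard for the group generator and that the commitment scheme is binding and equivocal. Then for every PPT adversary acting as the server in all rounds, every round $t\ge 1$ and every $i\in U_{unl}$ in round $t$, the probability that, in round $t$, $a'\neq a$ and device $i$ accepts is negligible in $\kappa$. -/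

import Mathlib

open scoped BigOperators

noncomputable section

namespace VerFU

/-! ### Data and probabilistic polynomial time -/

/-- Finite binary trees with natural numbers (that is, bit strings) at the leaves. -/
inductive Data : Type
  | num (n : ℕ) : Data
  | pair (a b : Data) : Data

namespace Data

instance : Inhabited Data := ⟨num 0⟩

/-- Length of the description of a datum in bits, up to a constant factor. -/
def size : Data → ℕ
  | num n => Nat.size n + 1
  | pair a b => size a + size b + 1

def fst : Data → Data
  | num _ => num 0
  | pair a _ => a

def snd : Data → Data
  | num _ => num 0
  | pair _ b => b

def toNat : Data → ℕ
  | num n => n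
  | pair _ _ => 0

/-- A list, coded by iterated pairing. -/
def list : List Data → Data
  | [] => num 0
  | a :: l => pair a (list l)

/-- The entry with index `k` of a coded list. -/
def nth : ℕ → Data → Data
  | 0, x => x.fst
  | k + 1, x => nth k x.snd

/-- A finite family, coded as a list. -/
def vec {n : ℕ} (v : Fin n → Data) : Data := list (List.ofFn v)

end Data

/-- The uniform distribution on a finite set (a point mass at `default` if the set is empty). -/
def unifOn {α : Type} [Inhabited α] (s : Finset α) : PMF α :=
  open Classical in if h : s.Nonempty then PMF.uniformOfFinset s h else PMF.pure default

/-- The uniform distribution on `{0, …, n - 1}`. -/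
def unif (n : ℕ) : PMF ℕ := unifOn (Finset.range n)

/-- Independent samples from finitely many distributions. -/
def tuple {α : Type} : {n : ℕ} → (Fin n → PMF α) → PMF (Fin n → α)
  | 0, _ => PMF.pure Fin.elim0
  | _ + 1, p => do
      let x ← p 0
      let xs ← tuple (fun i => p i.succ)
      PMF.pure (Fin.cons x xs)

/-- Arithmetical instructions, acting on pairs of numbers. -/
inductive Op : Type
  | add | sub | mul | div | mod

def Op.eval : Op → ℕ → ℕ → ℕ
  | .add, a, b => a + b
  | .sub, a, b => a - b
  | .mul, a, b => a * b
  | .div, a, b => a / b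
  | .mod, a, b => a % b

/-- Programs of the machine model: a probabilistic LOOP language on `Data`. -/
inductive Prog : Type
  | id : Prog
  | const (n : ℕ) : Prog
  | fst : Prog
  | snd : Prog
  | isPair : Prog
  | len : Prog
  | arith (o : Op) : Prog
  | rand : Prog
  | comp (f g : Prog) : Prog
  | pair (f g : Prog) : Prog
  | ite (c f g : Prog) : Prog
  | loop (f : Prog) : Prog

/-- Charge for one instruction executed on the datum `x`: the length of `x`, plus one. -/
def tick (x : Data) : ℕ := x.size + 1

/-- Semantics with step count: the joint distribution of the result and of the running time.
Each instruction is charged the length of the datum that it acts on (logarithmic cost), each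
iteration of a loop is charged separately. A function that a probabilistic Turing machine
computes in polynomial time is computed here in polynomial time, with a loop as a clock; and
conversely, up to the exponentially small error of sampling below `n` with fair coins. -/
def Prog.run : Prog → Data → PMF (Data × ℕ)
  | .id, x => PMF.pure (x, tick x)
  | .const n, x => PMF.pure (.num n, tick x)
  | .fst, x => PMF.pure (x.fst, tick x)
  | .snd, x => PMF.pure (x.snd, tick x)
  | .isPair, x => PMF.pure (match x with
      | .num _ => .num 0
      | .pair _ _ => .num 1, tick x)
  | .len, x => PMF.pure (.num (Nat.size x.toNat), tick x)
  | .arith o, x => PMF.pure (.num (o.eval x.fst.toNat x.snd.toNat), tick x)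
  | .rand, x => (unif x.toNat).map fun n => (.num n, tick x)
  -- first `f`, then `g` on its result
  | .comp f g, x => do
      let y ← f.run x
      let z ← g.run y.1
      PMF.pure (z.1, y.2 + z.2 + tick x)
  -- both `f` and `g` on a copy of the input
  | .pair f g, x => do
      let y ← f.run x
      let z ← g.run x
      PMF.pure (.pair y.1 z.1, y.2 + z.2 + tick x)
  -- `g` if the result of `c` is the number `0` or a pair, `f` otherwise
  | .ite c f g, x => do
      let b ← c.run x
      let y ← if b.1.toNat = 0 then g.run x else f.run x
      PMF.pure (y.1, b.2 + y.2 + tick x)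
  -- on the input `(n, y)`: `f` iterated `n` times, starting from `y`
  | .loop f, x =>
      Nat.rec (motive := fun _ => PMF (Data × ℕ)) (PMF.pure (x.snd, tick x))
        (fun _ ih => do
          let y ← ih
          let z ← f.run y.1
          PMF.pure (z.1, y.2 + z.2 + 1)) x.fst.toNat

/-- A randomized algorithm with security parameter `κ` and input `x` is probabilistic polynomial
time if a single program has its output distribution for all `κ` and `x`, and always
halts after a number of steps that is polynomial in `κ` and the length of `x`. -/
def IsPPT (D : ℕ → Data → PMF Data) : Prop :=
  ∃ (P : Prog) (p : Polynomial ℕ), ∀ (κ : ℕ) (x : Data),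
    (P.run (.pair (.num κ) x)).map Prod.fst = D κ x ∧
    ∀ y ∈ (P.run (.pair (.num κ) x)).support, y.2 ≤ p.eval (κ + x.size)

/-- A deterministic polynomial-time function. -/
def IsPolyTime (f : Data → Data) : Prop := IsPPT fun _ x => PMF.pure (f x)

/-- Negligible functions of the security parameter: `κ ^ c * f κ` tends to `0` for every `c`. -/
def Negligible (f : ℕ → ℝ) : Prop :=
  Asymptotics.SuperpolynomialDecay Filter.atTop (fun κ : ℕ => (κ : ℝ)) f

/-- The probability that an experiment ends with a true statement. -/
def Pr (μ : PMF Prop) : ℝ := (μ True).toReal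

/-! ### Groups of prime order and the linear homomorphic hash -/

/-- A generator of cyclic groups of prime order with an efficient multiplication. The parameters
`P` that `setup κ` outputs are a triple: a description of the group, its order and (the code of)
its generator. -/
structure GroupGen where
  setup : ℕ → PMF Data
  setup_ppt : IsPPT fun κ _ => setup κ
  G : Data → Type
  [grp : ∀ P, CommGroup (G P)]
  [fin : ∀ P, Fintype (G P)]
  prime : ∀ P, (Nat.card (G P)).Prime
  g : ∀ P, G P
  g_gen : ∀ P, ∀ x : G P, x ∈ Subgroup.zpowers (g P)
  /-- group elements are coded by bit strings, of length polynomial in `κ` -/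
  enc : ∀ P, G P → ℕ
  enc_inj : ∀ P, Function.Injective (enc P)
  enc_len : ∃ p : Polynomial ℕ, ∀ κ, ∀ P ∈ (setup κ).support, ∀ x : G P,
    Nat.size (enc P x) ≤ p.eval κ
  order_spec : ∀ κ, ∀ P ∈ (setup κ).support, P.nth 1 = .num (Nat.card (G P))
  g_spec : ∀ κ, ∀ P ∈ (setup κ).support, P.nth 2 = .num (enc P (g P))
  mulAlg : Data → Data
  mulAlg_poly : IsPolyTime mulAlg
  mul_spec : ∀ κ, ∀ P ∈ (setup κ).support, ∀ x y : G P,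
    mulAlg (.list [P, .num (enc P x), .num (enc P y)]) = .num (enc P (x * y))

attribute [instance] GroupGen.grp GroupGen.fin

namespace GroupGen

variable (𝒢 : GroupGen)

/-- The group order `q`. -/
abbrev q (P : Data) : ℕ := Nat.card (𝒢.G P)

/-- The discrete logarithm experiment. -/
def dlogExp (A : ℕ → Data → PMF Data) (κ : ℕ) : PMF Prop := do
  let P ← 𝒢.setup κ
  let x ← unif (𝒢.q P)
  let out ← A κ (.list [P, .num (𝒢.enc P (𝒢.g P ^ x))])
  PMF.pure (𝒢.g P ^ out.toNat = 𝒢.g P ^ x)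

/-- Hardness of the discrete logarithm problem. -/
def DLogHard : Prop := ∀ A, IsPPT A → Negligible fun κ => Pr (𝒢.dlogExp A κ)

/-- The bases of the hash for the dimension `d`: independent uniform group elements. -/
def hashBases (d : ℕ) (P : Data) : PMF (Fin d → 𝒢.G P) :=
  tuple fun _ => PMF.uniformOfFintype (𝒢.G P)

/-- `LHH.Hash`: the product of the `b k ^ m k`. -/
def hash {d : ℕ} {P : Data} (b : Fin d → 𝒢.G P) (m : Fin d → ZMod (𝒢.q P)) : 𝒢.G P :=
  ∏ k, b k ^ (m k).val

/-- `LHH.Eval` for the members of `U`: the product of the `h i ^ f i`. -/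
def hashEval {N : ℕ} {P : Data} (U : Finset (Fin N)) (h : Fin N → 𝒢.G P) (f : Fin N → ℤ) :
    𝒢.G P :=
  ∏ i ∈ U, h i ^ f i

end GroupGen

/-! ### Commitments -/

/-- A non-interactive commitment scheme with a trapdoor. The public parameters determine the
finite message space and the number of random strings; these are numbered from `0`. -/
structure CommitmentScheme where
  /-- `COM.Gen`, with output `(td, pp)` -/
  gen : ℕ → PMF (Data × Data)
  gen_ppt : IsPPT fun κ _ => (gen κ).map fun o => .pair o.1 o.2
  msgSpace : Data → Finset Data
  rndCard : Data → ℕ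
  rndCard_poly : IsPolyTime fun pp => .num (rndCard pp)
  /-- `COM.Com` on `pp`, the message `x` and the random string `r` -/
  com : Data → Data → Data → Data
  com_poly : IsPolyTime fun z => com (z.nth 0) (z.nth 1) (z.nth 2)
  /-- `COM.Equ` on the list `m, x, r, x', td` -/
  equ : ℕ → Data → PMF Data
  equ_ppt : IsPPT equ

namespace CommitmentScheme

variable (𝒞 : CommitmentScheme)

/-- `COM.Dec`: the opening `(x, r)` is valid for the commitment `m`. -/
def dec (pp m x r : Data) : Prop := m = 𝒞.com pp x r

/-- A uniformly random string for committing. -/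
def rnd (pp : Data) : PMF Data := (unif (𝒞.rndCard pp)).map .num

/-- The binding experiment; the adversary outputs the list `m, x, r, x', r'`. -/
def bindExp (A : ℕ → Data → PMF Data) (κ : ℕ) : PMF Prop := do
  let o ← 𝒞.gen κ
  let z ← A κ o.2
  let m := z.nth 0
  let x := z.nth 1
  let r := z.nth 2
  let x' := z.nth 3
  let r' := z.nth 4
  PMF.pure (x ∈ 𝒞.msgSpace o.2 ∧ x' ∈ 𝒞.msgSpace o.2 ∧
    𝒞.dec o.2 m x r ∧ 𝒞.dec o.2 m x' r' ∧ x ≠ x')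

def Binding : Prop := ∀ A, IsPPT A → Negligible fun κ => Pr (𝒞.bindExp A κ)

/-- The equivocation experiment for the message `x`; it is true if equivocation fails. -/
def equExp (x : Data → Data) (κ : ℕ) : PMF Prop := do
  let o ← 𝒞.gen κ
  let r ← 𝒞.rnd o.2
  let m := 𝒞.com o.2 (x o.2) r
  let x' ← unifOn (𝒞.msgSpace o.2)
  let r' ← 𝒞.equ κ (.list [m, x o.2, r, x', o.1])
  PMF.pure (¬ 𝒞.dec o.2 m x' r')

/-- Equivocality, for each choice of a message (in a message space that depends on `pp`). -/
def Equivocal : Prop := ∀ x : ℕ → Data → Data,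
  (∀ κ, ∀ o ∈ (𝒞.gen κ).support, x κ o.2 ∈ 𝒞.msgSpace o.2) →
    Negligible fun κ => Pr (𝒞.equExp (x κ) κ)

end CommitmentScheme

/-! ### The Paillier cryptosystem -/

/-- The numbers `p`, `q` and `g` chosen in the key generation. -/
structure PaillierKey where
  p : ℕ
  q : ℕ
  g : ℕ

namespace PaillierKey

variable (K : PaillierKey)

def n : ℕ := K.p * K.q

/-- Plaintexts. -/
abbrev Plain : Type := ZMod K.n

/-- Ciphertexts. -/
abbrev Cipher : Type := ZMod (K.n ^ 2)

def lam : ℕ := Nat.lcm (K.p - 1) (K.q - 1)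

/-- `L (x) = (x - 1) / n`. -/
def L (x : K.Cipher) : K.Plain := (((x.val - 1) / K.n : ℕ) : K.Plain)

def mu : K.Plain := (K.L ((K.g : K.Cipher) ^ K.lam))⁻¹

/-- The requirements on a key: distinct primes with `gcd (p q, (p - 1) (q - 1)) = 1`,
`g` invertible modulo `n ^ 2`, and the inverse defining `mu` exists. -/
def Valid : Prop :=
  K.p.Prime ∧ K.q.Prime ∧ K.p ≠ K.q ∧ Nat.Coprime (K.p * K.q) ((K.p - 1) * (K.q - 1)) ∧
    IsUnit (K.g : K.Cipher) ∧ IsUnit (K.L ((K.g : K.Cipher) ^ K.lam))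

/-- Encryption with a random `r` in `{0, …, n - 1}` coprime to `n`. -/
def encrypt (c : K.Plain) : PMF K.Cipher := do
  let r ← unifOn ((Finset.range K.n).filter (Nat.Coprime K.n))
  PMF.pure ((K.g : K.Cipher) ^ c.val * (r : K.Cipher) ^ K.n)

def decrypt (c : K.Cipher) : K.Plain := K.L (c ^ K.lam) * K.mu

/-- An element of `ZMod q` as a plaintext, through its representative of least absolute value. -/
def encode {q : ℕ} (x : ZMod q) : K.Plain := (x.valMinAbs : K.Plain)

def decode {q : ℕ} (y : K.Plain) : ZMod q := (y.valMinAbs : ZMod q)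

/-- Entrywise encryption of a vector. -/
def encVec {q d : ℕ} (x : Fin d → ZMod q) : PMF (Fin d → K.Cipher) :=
  tuple fun k => K.encrypt (K.encode (x k))

/-- Entrywise decryption of a vector. -/
def decVec {q d : ℕ} (c : Fin d → K.Cipher) : Fin d → ZMod q :=
  fun k => K.decode (K.decrypt (c k))

/-- Homomorphic addition of ciphertexts of the members of `U`, minus those of the members
of `V`. -/
def aggregate {N d : ℕ} (U V : Finset (Fin N)) (x : Fin N → Fin d → K.Cipher) :
    Fin d → K.Cipher :=
  fun k => (∏ i ∈ U, x i k) * (∏ j ∈ V, x j k)⁻¹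

end PaillierKey

/-! ### The protocol -/

/-- A federated unlearning system with `N` devices and models of dimension `d`. -/
structure System (N d : ℕ) where
  /-- the group generator of the hash -/
  lhh : GroupGen
  /-- the commitment scheme -/
  com : CommitmentScheme
  /-- the choice of the numbers `p`, `q`, `g` in `HE.Gen` -/
  heGen : ℕ → PMF PaillierKey
  heGen_ppt : IsPPT fun κ _ => (heGen κ).map fun K => .list [.num K.p, .num K.q, .num K.g]
  /-- the list of the private datasets of all devices -/
  dataGen : ℕ → PMF Data
  dataGen_ppt : IsPPT fun κ _ => dataGen κ
  /-- local training. The input is the list: round, device, dataset of the device, `q`, initial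
  model, and the list of the results decrypted in the earlier rounds, the latest one first
  (these determine the current global model). The output is the list of the entries of the
  gradient, reduced modulo `q`. -/
  train : ℕ → Data → PMF Data
  train_ppt : IsPPT train
  /-- the devices that participate in a round -/
  users : ℕ → Finset (Fin N)
  /-- those of them that request unlearning in that round -/
  unl : ℕ → Finset (Fin N)
  unl_sub : ∀ t, unl t ⊆ users t

/-- What is carried from one round to the next, and the outcome of the last round. -/
structure State (N d q : ℕ) where
  /-- the private state of the adversary -/
  adv : Data
  /-- the results that the devices decrypted, the latest one first -/
  hist : List (Fin d → ZMod q)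
  /-- the historical contributions of the devices -/
  cv : Fin N → Fin d → ZMod q
  /-- the devices that accepted a forged result in the last round -/
  fooled : Fin N → Prop

namespace System

variable {N d : ℕ} (S : System N d)

/-- Normal devices. -/
def nor (t : ℕ) : Finset (Fin N) := S.users t \ S.unl t

/-- Status indicators. -/
def status (t : ℕ) (i : Fin N) : ℤ := if i ∈ S.unl t then -1 else 1

/-- Everything that is set up once: the group parameters, the bases of the hash, the public
parameters of the commitment scheme, the Paillier key, the datasets, the initial model. -/
structure Setup where
  P : Data
  b : Fin d → S.lhh.G P
  pp : Data
  K : PaillierKey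
  D : Data
  w : Data

variable {S}

/-- A device accepts `a'` if it can parse the relayed openings of all other devices as hash values
`h'` with valid openings of the broadcast commitments `m`, and if the hash of `a'` is the linear
combination of these and of its own hash value. -/
def accepts (E : S.Setup) (t : ℕ) (i : Fin N) (m : Fin N → Data)
    (h : Fin N → S.lhh.G E.P) (opn : Fin N → Data) (a' : Fin d → ZMod (S.lhh.q E.P)) : Prop :=
  ∃ h' : Fin N → S.lhh.G E.P, h' i = h i ∧
    (∀ j ∈ S.users t, j ≠ i → (opn j).fst = .num (S.lhh.enc E.P (h' j)) ∧
      S.com.dec E.pp (m j) (.num (S.lhh.enc E.P (h' j))) (opn j).snd) ∧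
    S.lhh.hash E.b a' = S.lhh.hashEval (S.users t) h' (S.status t)

/-- Round `t` with the adversary `A` as the server. Commitments and status indicators reach all
devices unchanged; the adversary chooses the ciphertext that it returns, and the openings that it
passes on. -/
def round (A : ℕ → Data → PMF Data) (κ : ℕ) (E : S.Setup) (t : ℕ)
    (σ : State N d (S.lhh.q E.P)) : PMF (State N d (S.lhh.q E.P)) := do
  -- preparation: training, hashing, committing
  let vs ← tuple fun i : Fin N => S.train κ (.list [.num t, .num i, E.D.nth i,
    .num (S.lhh.q E.P), E.w, .list (σ.hist.map fun a => .vec fun k => .num (a k).val)])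
  let v : Fin N → Fin d → ZMod (S.lhh.q E.P) := fun i k => (((vs i).nth k).toNat : ZMod _)
  let cv := fun i => if i ∈ S.users t then σ.cv i + v i else σ.cv i
  let contrib := fun i => if i ∈ S.unl t then cv i else v i
  let h := fun i => S.lhh.hash E.b (contrib i)
  let r ← tuple fun _ : Fin N => S.com.rnd E.pp
  let m := fun i => S.com.com E.pp (.num (S.lhh.enc E.P (h i))) (r i)
  -- aggregation and unlearning: the honest result `a` and the adversary's result `a'`
  let x ← tuple fun i : Fin N => E.K.encVec (contrib i)
  let y ← A κ (.pair σ.adv (.vec fun i : Fin N => if i ∈ S.users t then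
    .list [m i, .vec fun k => .num (x i k).val, .num (if i ∈ S.unl t then 0 else 1)] else .num 0))
  let a : Fin d → ZMod (S.lhh.q E.P) := E.K.decVec (E.K.aggregate (S.nor t) (S.unl t) x)
  let a' : Fin d → ZMod (S.lhh.q E.P) :=
    E.K.decVec fun k => ((y.snd.nth k).toNat : E.K.Cipher)
  -- verification: the devices open their commitments to the server, which passes on openings
  let z ← A κ (.pair y.fst (.vec fun i : Fin N => if i ∈ S.users t then
    .pair (.num (S.lhh.enc E.P (h i))) (r i) else .num 0))
  PMF.pure
    { adv := z.fst
      hist := a' :: σ.hist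
      cv := cv
      fooled := fun i => i ∈ S.unl t ∧ a' ≠ a ∧ accepts E t i m h (fun j => z.snd.nth j) a' }

/-- The first `t` rounds. -/
def rounds (A : ℕ → Data → PMF Data) (κ : ℕ) (E : S.Setup) (adv : Data) :
    ℕ → PMF (State N d (S.lhh.q E.P))
  | 0 => PMF.pure { adv := adv, hist := [], cv := 0, fooled := fun _ => False }
  | t + 1 => do
      let σ ← rounds A κ E adv t
      round A κ E (t + 1) σ

variable (S)

/-- The integrity experiment: in round `t`, device `i` accepts a forged result. The adversary
starts with all public parameters and chooses the initial model. -/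
def integrityExp (A : ℕ → Data → PMF Data) (t : ℕ) (i : Fin N) (κ : ℕ) : PMF Prop := do
  let P ← S.lhh.setup κ
  let b ← S.lhh.hashBases d P
  let o ← S.com.gen κ
  let K ← S.heGen κ
  let D ← S.dataGen κ
  let y ← A κ (.pair (.num 0)
    (.list [P, .vec fun k => .num (S.lhh.enc P (b k)), o.2, .num K.n, .num K.g]))
  let σ ← rounds A κ { P := P, b := b, pp := o.2, K := K, D := D, w := y.snd } y.fst t
  PMF.pure (σ.fooled i)

/-- Integrity of unlearning: in each round, each verifying device outputs a failure on a forged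
result except with negligible probability. -/
def UnlearningIntegrity : Prop :=
  ∀ A, IsPPT A → ∀ t, 1 ≤ t → ∀ i ∈ S.unl t, Negligible fun κ => Pr (S.integrityExp A t i κ)

/-- True if the Paillier key does not meet the requirements or if its plaintext space is too small
for an aggregate of `N` vectors with entries in `ZMod q`. -/
def badKeyExp (κ : ℕ) : PMF Prop := do
  let P ← S.lhh.setup κ
  let K ← S.heGen κ
  PMF.pure (¬ (K.Valid ∧ N * S.lhh.q P < K.n))

/-- Hash values are messages of the commitment scheme. -/
def HashesAreMessages : Prop :=
  ∀ κ, ∀ P ∈ (S.lhh.setup κ).support, ∀ o ∈ (S.com.gen κ).support, ∀ x : S.lhh.G P,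
    Data.num (S.lhh.enc P x) ∈ S.com.msgSpace o.2

end System

end VerFU

end

noncomputable section
namespace VerFU

open scoped ENNReal

/-! ### Polynomial bounds -/

/-! Suppose that device `i` accepts some `a' ≠ a`, and let `h' j` be the hash values relayed to it.
If every `h' j` equals the honest `h j`, linearity of the hash turns the acceptance equation into
`Hash(a') = Hash(∑ c i - ∑ c j)`, with normal devices in the first sum and unlearning devices in the
second. Correctness of Paillier, where `N q < n` rules out wrap-around, identifies the argument on
the right with `a`, so `a` and `a'` collide. Otherwise some `j ≠ i` has `h' j ≠ h j`, and the
commitment of `j` has valid openings to both values. This dichotomy is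
`exists_doubleOpening_or_collision`.

A double opening contradicts binding. A collision solves a discrete logarithm: the challenge is
planted as the base with index `k`, the logarithms of all other bases being known. Equality of the
hashes is then a linear equation modulo `q` for the unknown logarithm, with coefficient `a' k - a
k`, which is invertible for some `k` (`Collision.pow_solveLog`). There is one reduction for each
device `j` and one for each coordinate `k`. These are finitely many, and a union bound adds up their
advantages (`integrityExp_le`).

Both reductions run the whole protocol themselves, with a Paillier key of their own, on codes of the
objects (`simBody`). The simulation departs from the protocol in the randomness of encryption, which
it draws among all residues modulo `n` instead of those prime to `n`. The two laws need not be
statistically close, as a valid key may have a small prime factor. But `φ(n) ≥ n / 3`, so the true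
density is at most `3` times the simulated one, and the `d * N` ciphertexts in each of `t` rounds
cost a factor `3 ^ (d * N * t)`, constant in `κ`. For this reason experiments are compared by the
multiplicative relation `Dom`; the comparison of the protocol with its simulation is `dom_rounds`.
Unsuitable keys are accounted for separately by `badKeyExp`.

The remaining work is to show that the reductions are polynomial time in the machine model. It rests
on the bound of output length by running time (`Prog.size_output_le`), on closure under sampling and
bounded iteration (`IsPPT.bind_pair`, `IsPPT.bind_tuple`, `PolyFun.iterate`), and on explicit
algorithms for powers, gcd, hashing, encryption and decryption. -/

theorem polynomial_eval_mono (p : Polynomial ℕ) {m n : ℕ} (h : m ≤ n) : p.eval m ≤ p.eval n := by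
  simp only [Polynomial.eval_eq_sum, Polynomial.sum]
  exact Finset.sum_le_sum fun i _ => Nat.mul_le_mul_left _ (Nat.pow_le_pow_left h i)

/-- `T` is bounded by a polynomial in the security parameter and the length of the input. -/
def PolyBdd (T : ℕ → Data → ℕ) : Prop :=
  ∃ p : Polynomial ℕ, ∀ κ x, T κ x ≤ p.eval (κ + x.size)

namespace PolyBdd

theorem mono {S T : ℕ → Data → ℕ} (hT : PolyBdd T) (h : ∀ κ x, S κ x ≤ T κ x) : PolyBdd S := by
  obtain ⟨p, hp⟩ := hT
  exact ⟨p, fun κ x => (h κ x).trans (hp κ x)⟩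

theorem const (c : ℕ) : PolyBdd fun _ _ => c := ⟨.C c, fun _ _ => by simp⟩

theorem param : PolyBdd fun κ _ => κ := ⟨.X, fun _ _ => by simp⟩

theorem size : PolyBdd fun _ x => x.size := ⟨.X, fun _ _ => by simp⟩

theorem add {S T : ℕ → Data → ℕ} (hS : PolyBdd S) (hT : PolyBdd T) :
    PolyBdd fun κ x => S κ x + T κ x := by
  obtain ⟨p, hp⟩ := hS
  obtain ⟨r, hr⟩ := hT
  exact ⟨p + r, fun κ x => by simpa using add_le_add (hp κ x) (hr κ x)⟩

theorem mul {S T : ℕ → Data → ℕ} (hS : PolyBdd S) (hT : PolyBdd T) :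
    PolyBdd fun κ x => S κ x * T κ x := by
  obtain ⟨p, hp⟩ := hS
  obtain ⟨r, hr⟩ := hT
  exact ⟨p * r, fun κ x => by simpa using Nat.mul_le_mul (hp κ x) (hr κ x)⟩

theorem eval (p : Polynomial ℕ) {S : ℕ → Data → ℕ} (hS : PolyBdd S) :
    PolyBdd fun κ x => p.eval (S κ x) := by
  obtain ⟨r, hr⟩ := hS
  exact ⟨p.comp r, fun κ x => by
    simpa [Polynomial.eval_comp] using polynomial_eval_mono p (hr κ x)⟩

/-- Bounds may be composed with inputs of polynomial length. -/
theorem comp {S T : ℕ → Data → ℕ} (hT : PolyBdd T) (hS : PolyBdd S) :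
    ∃ R : ℕ → Data → ℕ, PolyBdd R ∧ ∀ κ x y, y.size ≤ S κ x → T κ y ≤ R κ x := by
  obtain ⟨p, hp⟩ := hT
  exact ⟨_, (param.add hS).eval p, fun κ x y h =>
    (hp κ y).trans (polynomial_eval_mono p (by omega))⟩

end PolyBdd

/-! ### Running programs -/

theorem bind_congr_support {α β : Type*} {p : PMF α} {f g : α → PMF β}
    (h : ∀ a ∈ p.support, f a = g a) : p.bind f = p.bind g := by
  ext b
  simp only [PMF.bind_apply]
  refine tsum_congr fun a => ?_
  by_cases ha : p a = 0
  · simp [ha]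
  · rw [h a ((PMF.mem_support_iff _ _).2 ha)]

/-- On the input `x`, the program `P` has the output distribution `μ` and halts within `T` steps. -/
def Runs (P : Prog) (x : Data) (μ : PMF Data) (T : ℕ) : Prop :=
  (P.run x).map Prod.fst = μ ∧ ∀ y ∈ (P.run x).support, y.2 ≤ T

namespace Runs

variable {f g c : Prog} {x : Data} {μ : PMF Data} {T T' : ℕ}

theorem mono (h : Runs f x μ T) (hT : T ≤ T') : Runs f x μ T' :=
  ⟨h.1, fun y hy => (h.2 y hy).trans hT⟩

theorem of_pure {y : Data} {t : ℕ} (h : f.run x = PMF.pure (y, t)) : Runs f x (PMF.pure y) t := by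
  refine ⟨by rw [h, PMF.pure_map], fun z hz => ?_⟩
  rw [h, PMF.mem_support_pure_iff] at hz
  rw [hz]

theorem fst_mem_support (h : Runs f x μ T) {y : Data × ℕ} (hy : y ∈ (f.run x).support) :
    y.1 ∈ μ.support := by
  rw [← h.1]
  exact (PMF.mem_support_map_iff _ _ _).2 ⟨y, hy, rfl⟩

theorem comp {ν : Data → PMF Data} (hf : Runs f x μ T)
    (hg : ∀ y ∈ μ.support, Runs g y (ν y) T') :
    Runs (.comp f g) x (μ.bind ν) (T + T' + tick x) := by
  constructor
  · simp only [Prog.run, Bind.bind, PMF.map_bind, PMF.pure_map]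
    rw [← hf.1, PMF.bind_map]
    exact bind_congr_support fun y hy => (hg y.1 (hf.fst_mem_support hy)).1
  · intro y hy
    simp only [Prog.run, Bind.bind, PMF.mem_support_bind_iff, PMF.mem_support_pure_iff] at hy
    obtain ⟨a, ha, b, hb, rfl⟩ := hy
    have h1 := hf.2 a ha
    have h2 := (hg a.1 (hf.fst_mem_support ha)).2 b hb
    dsimp only
    omega

theorem comp_pure {y : Data} (hf : Runs f x (PMF.pure y) T) (hg : Runs g y μ T') :
    Runs (.comp f g) x μ (T + T' + tick x) := by
  have := hf.comp (g := g) (ν := fun _ => μ) (T' := T') fun z hz => by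
    rw [PMF.mem_support_pure_iff] at hz
    rwa [hz]
  rwa [PMF.bind_const] at this

theorem pair {ν : PMF Data} (hf : Runs f x μ T) (hg : Runs g x ν T') :
    Runs (.pair f g) x (μ.bind fun a => ν.map (Data.pair a)) (T + T' + tick x) := by
  constructor
  · simp only [Prog.run, Bind.bind, PMF.map_bind, PMF.pure_map]
    rw [← hf.1, ← hg.1, PMF.bind_map]
    simp only [Function.comp_def, PMF.map_comp]
    rfl
  · intro y hy
    simp only [Prog.run, Bind.bind, PMF.mem_support_bind_iff, PMF.mem_support_pure_iff] at hy
    obtain ⟨a, ha, b, hb, rfl⟩ := hy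
    have h1 := hf.2 a ha
    have h2 := hg.2 b hb
    dsimp only
    omega

theorem pair_pure {y : Data} {ν : PMF Data} (hf : Runs f x (PMF.pure y) T) (hg : Runs g x ν T') :
    Runs (.pair f g) x (ν.map (Data.pair y)) (T + T' + tick x) := by
  simpa using hf.pair hg

theorem ite {b : Data} (hc : Runs c x (PMF.pure b) T)
    (hg : Runs (if b.toNat = 0 then g else f) x μ T') :
    Runs (.ite c f g) x μ (T + T' + tick x) := by
  have hb : ∀ a ∈ (c.run x).support, a.1 = b := fun a ha => by
    simpa using hc.fst_mem_support ha
  have hr : Prog.run (.ite c f g) x = (c.run x).bind fun a =>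
      (Prog.run (if b.toNat = 0 then g else f) x).bind fun y =>
        PMF.pure (y.1, a.2 + y.2 + tick x) := by
    simp only [Prog.run, Bind.bind]
    refine bind_congr_support fun a ha => ?_
    rw [hb a ha]
    split_ifs <;> rfl
  constructor
  · rw [hr]
    simp only [PMF.map_bind, PMF.pure_map]
    rw [PMF.bind_const]
    exact hg.1
  · intro y hy
    simp only [hr, PMF.mem_support_bind_iff, PMF.mem_support_pure_iff] at hy
    obtain ⟨a, ha, z, hz, rfl⟩ := hy
    have h1 := hc.2 a ha
    have h2 := hg.2 z hz
    dsimp only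
    omega

theorem loop {n : ℕ} {s : ℕ → Data} (hf : ∀ k < n, Runs f (s k) (PMF.pure (s (k + 1))) T) :
    Runs (.loop f) (.pair (.num n) (s 0)) (PMF.pure (s n))
      (tick (.pair (.num n) (s 0)) + n * (T + 1)) := by
  -- The recursor in the semantics of `loop` is replaced by an arbitrary sequence `F` with the same
  -- recursion equations, which hold by `rfl` at the end. The bound `m ≤ n` is needed since `hf`
  -- only speaks of the first `n` iterations.
  have key : ∀ F : ℕ → PMF (Data × ℕ), F 0 = PMF.pure (s 0, tick (.pair (.num n) (s 0))) →
      (∀ m, F (m + 1) = (F m).bind fun y => (f.run y.1).bind fun z =>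
        PMF.pure (z.1, y.2 + z.2 + 1)) → ∀ m ≤ n,
      (F m).map Prod.fst = PMF.pure (s m) ∧
        ∀ y ∈ (F m).support, y.2 ≤ tick (.pair (.num n) (s 0)) + m * (T + 1) := by
    intro F h0 hs m
    induction m with
    | zero =>
      rintro -
      rw [h0]
      refine ⟨by simp [PMF.pure_map], fun y hy => ?_⟩
      rw [PMF.mem_support_pure_iff] at hy
      simp [hy]
    | succ m ih =>
      intro hm
      obtain ⟨h1, h2⟩ := ih (by omega)
      have hρ : ∀ a ∈ (F m).support, a.1 = s m := fun a ha => by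
        have : a.1 ∈ ((F m).map Prod.fst).support := (PMF.mem_support_map_iff _ _ _).2 ⟨a, ha, rfl⟩
        rwa [h1, PMF.mem_support_pure_iff] at this
      have hm' := hf m (by omega)
      rw [hs]
      constructor
      · simp only [PMF.map_bind, PMF.pure_map]
        rw [bind_congr_support (g := fun _ => PMF.pure (s (m + 1))), PMF.bind_const]
        intro a ha
        rw [hρ a ha]
        exact hm'.1
      · intro y hy
        simp only [PMF.mem_support_bind_iff, PMF.mem_support_pure_iff] at hy
        obtain ⟨a, ha, b, hb, rfl⟩ := hy
        have e1 := h2 a ha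
        rw [hρ a ha] at hb
        have e2 := hm'.2 b hb
        dsimp only
        rw [add_mul]
        omega
  exact key _ rfl (fun _ => rfl) n le_rfl

end Runs

/-! ### Lengths of data and of program outputs. -/

theorem Data.size_fst_le (x : Data) : x.fst.size ≤ x.size := by
  cases x <;> simp [Data.size, Data.fst]
  omega

theorem Data.size_snd_le (x : Data) : x.snd.size ≤ x.size := by
  cases x <;> simp [Data.size, Data.snd]
  omega

theorem Data.size_toNat_le (x : Data) : Nat.size x.toNat < x.size := by
  cases x <;> simp [Data.size, Data.toNat]

theorem size_fst_add_snd_le (x : Data) : Nat.size x.fst.toNat + Nat.size x.snd.toNat ≤ x.size := by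
  cases x with
  | num n => simp [Data.fst, Data.snd, Data.toNat]
  | pair a b =>
    have := a.size_toNat_le
    have := b.size_toNat_le
    simp only [Data.fst, Data.snd, Data.size]
    omega

theorem natSize_le_self (n : ℕ) : Nat.size n ≤ n := Nat.size_le.2 n.lt_two_pow_self

theorem natSize_add_le (a b : ℕ) : Nat.size (a + b) ≤ Nat.size a + Nat.size b + 1 := by
  rw [Nat.size_le, pow_succ, pow_add]
  have ha := Nat.lt_size_self a
  have hb := Nat.lt_size_self b
  nlinarith [Nat.one_le_two_pow (n := Nat.size a), Nat.one_le_two_pow (n := Nat.size b)]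

theorem natSize_mul_le (a b : ℕ) : Nat.size (a * b) ≤ Nat.size a + Nat.size b := by
  rw [Nat.size_le, pow_add]
  exact Nat.mul_lt_mul'' (Nat.lt_size_self a) (Nat.lt_size_self b)

theorem Op.size_eval_le (o : Op) (a b : ℕ) :
    Nat.size (o.eval a b) ≤ Nat.size a + Nat.size b + 1 := by
  have ha : ∀ c ≤ a, Nat.size c ≤ Nat.size a + Nat.size b + 1 := fun c hc =>
    (Nat.size_le_size hc).trans (by omega)
  cases o with
  | add => exact natSize_add_le a b
  | sub => exact ha _ (Nat.sub_le _ _)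
  | mul => exact (natSize_mul_le a b).trans (by omega)
  | div => exact ha _ (Nat.div_le_self _ _)
  | mod => exact ha _ (Nat.mod_le _ _)

theorem mem_support_unif {n k : ℕ} (h : k ∈ (unif n).support) : k ≤ n := by
  unfold unif unifOn at h
  split_ifs at h with hn
  · rw [PMF.mem_support_uniformOfFinset_iff, Finset.mem_range] at h
    exact h.le
  · rw [PMF.mem_support_pure_iff] at h
    simp [h]

/-- The length of the output of a program is at most proportional to its running time. -/
theorem Prog.size_output_le (P : Prog) :
    ∃ C : ℕ, 1 ≤ C ∧ ∀ x, ∀ y ∈ (P.run x).support, y.1.size ≤ C * y.2 := by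
  have key : ∀ (s : ℕ) (x : Data) (C : ℕ), s ≤ C → s ≤ C * tick x := fun s x C h =>
    h.trans (Nat.le_mul_of_pos_right _ (Nat.succ_pos _))
  induction P with
  | id =>
    refine ⟨1, le_rfl, fun x y hy => ?_⟩
    simp only [Prog.run, PMF.mem_support_pure_iff] at hy
    simp [hy, tick]
  | const n =>
    refine ⟨Nat.size n + 1, by omega, fun x y hy => ?_⟩
    simp only [Prog.run, PMF.mem_support_pure_iff] at hy
    rw [hy]
    exact key _ _ _ le_rfl
  | fst =>
    refine ⟨1, le_rfl, fun x y hy => ?_⟩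
    simp only [Prog.run, PMF.mem_support_pure_iff] at hy
    have := x.size_fst_le
    simp only [hy, tick]
    omega
  | snd =>
    refine ⟨1, le_rfl, fun x y hy => ?_⟩
    simp only [Prog.run, PMF.mem_support_pure_iff] at hy
    have := x.size_snd_le
    simp only [hy, tick]
    omega
  | isPair =>
    refine ⟨2, by omega, fun x y hy => ?_⟩
    simp only [Prog.run, PMF.mem_support_pure_iff] at hy
    rw [hy]
    refine key _ _ _ ?_
    cases x <;> simp [Data.size]
  | len =>
    refine ⟨1, le_rfl, fun x y hy => ?_⟩
    simp only [Prog.run, PMF.mem_support_pure_iff] at hy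
    have := x.size_toNat_le
    have := natSize_le_self (Nat.size x.toNat)
    simp only [hy, tick, Data.size]
    omega
  | arith o =>
    refine ⟨2, by omega, fun x y hy => ?_⟩
    simp only [Prog.run, PMF.mem_support_pure_iff] at hy
    have := size_fst_add_snd_le x
    have := o.size_eval_le x.fst.toNat x.snd.toNat
    simp only [hy, tick, Data.size]
    omega
  | rand =>
    refine ⟨1, le_rfl, fun x y hy => ?_⟩
    simp only [Prog.run, PMF.mem_support_map_iff] at hy
    obtain ⟨k, hk, rfl⟩ := hy
    have := x.size_toNat_le
    have := Nat.size_le_size (mem_support_unif hk)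
    simp only [tick, Data.size]
    omega
  | comp f g _ hg =>
    obtain ⟨C, hC, h⟩ := hg
    refine ⟨C, hC, fun x y hy => ?_⟩
    simp only [Prog.run, Bind.bind, PMF.mem_support_bind_iff, PMF.mem_support_pure_iff] at hy
    obtain ⟨a, ha, b, hb, rfl⟩ := hy
    exact (h _ b hb).trans (Nat.mul_le_mul_left _ (by omega))
  | pair f g hf hg =>
    obtain ⟨C, hC, h⟩ := hf
    obtain ⟨C', hC', h'⟩ := hg
    refine ⟨C + C', by omega, fun x y hy => ?_⟩
    simp only [Prog.run, Bind.bind, PMF.mem_support_bind_iff, PMF.mem_support_pure_iff] at hy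
    obtain ⟨a, ha, b, hb, rfl⟩ := hy
    have h1 := h _ a ha
    have h2 := h' _ b hb
    simp only [Data.size, tick]
    nlinarith [Nat.zero_le (C * b.2), Nat.zero_le (C' * a.2), Nat.zero_le (C * x.size),
      Nat.zero_le (C' * x.size)]
  | ite c f g _ hf hg =>
    obtain ⟨C, hC, h⟩ := hf
    obtain ⟨C', hC', h'⟩ := hg
    refine ⟨C + C', by omega, fun x y hy => ?_⟩
    simp only [Prog.run, Bind.bind, PMF.mem_support_bind_iff] at hy
    obtain ⟨a, ha, hy⟩ := hy
    split_ifs at hy <;> simp only [PMF.mem_support_bind_iff, PMF.mem_support_pure_iff] at hy <;>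
      obtain ⟨b, hb, rfl⟩ := hy
    · exact (h' _ b hb).trans (Nat.mul_le_mul (by omega) (by omega))
    · exact (h _ b hb).trans (Nat.mul_le_mul (by omega) (by omega))
  | loop f hf =>
    obtain ⟨C, hC, h⟩ := hf
    refine ⟨C, hC, fun x => ?_⟩
    -- No induction on the number of iterations is needed: the result comes from the last run of
    -- `f`, whose own running time pays for it, or from the initial `tick` if there is no iteration.
    have key : ∀ F : ℕ → PMF (Data × ℕ), F 0 = PMF.pure (x.snd, tick x) →
        (∀ m, F (m + 1) = (F m).bind fun y => (f.run y.1).bind fun z =>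
          PMF.pure (z.1, y.2 + z.2 + 1)) → ∀ m, ∀ y ∈ (F m).support, y.1.size ≤ C * y.2 := by
      intro F h0 hs m y hy
      cases m with
      | zero =>
        rw [h0, PMF.mem_support_pure_iff] at hy
        rw [hy]
        have := x.size_snd_le
        simp only [tick]
        nlinarith
      | succ m =>
        rw [hs] at hy
        simp only [PMF.mem_support_bind_iff, PMF.mem_support_pure_iff] at hy
        obtain ⟨a, ha, b, hb, rfl⟩ := hy
        exact (h _ b hb).trans (Nat.mul_le_mul_left _ (by omega))
    exact key _ rfl (fun _ => rfl) x.fst.toNat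

/-! ### Closure properties of probabilistic polynomial time -/

theorem isPPT_iff {D : ℕ → Data → PMF Data} : IsPPT D ↔ ∃ (P : Prog) (T : ℕ → Data → ℕ),
    PolyBdd T ∧ ∀ κ x, Runs P (.pair (.num κ) x) (D κ x) (T κ x) := by
  constructor
  · rintro ⟨P, p, h⟩
    exact ⟨P, fun κ x => p.eval (κ + x.size), ⟨p, fun _ _ => le_rfl⟩, h⟩
  · rintro ⟨P, T, ⟨p, hp⟩, h⟩
    exact ⟨P, p, fun κ x => (h κ x).mono (hp κ x)⟩

/-- Deterministic functions of the security parameter and an input, computable in polynomial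
time. -/
def PolyFun (f : ℕ → Data → Data) : Prop := IsPPT fun κ x => PMF.pure (f κ x)

/-- Numerical functions computable in polynomial time. -/
def PolyNum (f : ℕ → Data → ℕ) : Prop := PolyFun fun κ x => .num (f κ x)

theorem polyBdd_tick : PolyBdd fun κ x => tick (.pair (.num κ) x) :=
  ((PolyBdd.param.add PolyBdd.size).add (PolyBdd.const 3)).mono fun κ x => by
    have := natSize_le_self κ
    simp only [tick, Data.size]
    omega

namespace Runs

variable {κ : ℕ} {x : Data}

theorem fst' : Runs .fst (.pair (.num κ) x) (PMF.pure (.num κ)) (tick (.pair (.num κ) x)) :=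
  of_pure rfl

theorem snd' : Runs .snd (.pair (.num κ) x) (PMF.pure x) (tick (.pair (.num κ) x)) :=
  of_pure rfl

end Runs

namespace IsPPT

variable {D D₁ D₂ : ℕ → Data → PMF Data}

/-- A program pays for the length of its output. This makes sequential composition polynomial: the
second algorithm runs on an input of polynomial length. -/
theorem size_le (hD : IsPPT D) :
    ∃ S, PolyBdd S ∧ ∀ κ x, ∀ y ∈ (D κ x).support, y.size ≤ S κ x := by
  obtain ⟨P, T, hT, h⟩ := isPPT_iff.1 hD
  obtain ⟨C, -, hC⟩ := P.size_output_le
  refine ⟨_, (PolyBdd.const C).mul hT, fun κ x y hy => ?_⟩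
  rw [← (h κ x).1, PMF.mem_support_map_iff] at hy
  obtain ⟨z, hz, rfl⟩ := hy
  exact (hC _ z hz).trans (Nat.mul_le_mul_left _ ((h κ x).2 z hz))

/-- The continuation receives the original input along with the sample, so nested samples build up a
context of nested pairs. The form `bind` with a curried continuation agrees with it definitionally.
-/
theorem bind_pair (hD : IsPPT D) (hE : IsPPT D₁) :
    IsPPT fun κ x => (D κ x).bind fun y => D₁ κ (.pair x y) := by
  obtain ⟨S, hS, hS'⟩ := hD.size_le
  obtain ⟨P, T, hT, hP⟩ := isPPT_iff.1 hD
  obtain ⟨Q, U, hU, hQ⟩ := isPPT_iff.1 hE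
  obtain ⟨R, hR, hR'⟩ := hU.comp ((PolyBdd.size.add hS).add (PolyBdd.const 1))
  refine isPPT_iff.2 ⟨.comp (.pair .fst (.pair .snd P)) Q,
    fun κ x => tick (.pair (.num κ) x) + (tick (.pair (.num κ) x) + T κ x +
      tick (.pair (.num κ) x)) + tick (.pair (.num κ) x) + R κ x + tick (.pair (.num κ) x),
    (((polyBdd_tick.add ((polyBdd_tick.add hT).add polyBdd_tick)).add polyBdd_tick).add hR).add
      polyBdd_tick, fun κ x => ?_⟩
  have h1 := Runs.fst'.pair_pure (Runs.snd'.pair_pure (hP κ x))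
  have h2 := h1.comp (g := Q) (ν := fun z => D₁ κ z.snd) (T' := R κ x) ?_
  · rw [PMF.map_comp, PMF.bind_map] at h2
    exact h2
  · intro z hz
    simp only [PMF.mem_support_map_iff] at hz
    obtain ⟨_, ⟨y, hy, rfl⟩, rfl⟩ := hz
    refine (hQ κ (.pair x y)).mono (hR' _ _ _ ?_)
    have := hS' _ _ _ hy
    simp only [Data.size]
    omega

theorem bind {E : ℕ → Data → Data → PMF Data} (hD : IsPPT D)
    (hE : IsPPT fun κ z => E κ z.fst z.snd) : IsPPT fun κ x => (D κ x).bind (E κ x) :=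
  hD.bind_pair hE

theorem comp {f : ℕ → Data → Data} (hD : IsPPT D) (hf : PolyFun f) :
    IsPPT fun κ x => D κ (f κ x) := by
  obtain ⟨S, hS, hS'⟩ := hf.size_le
  obtain ⟨P, T, hT, hP⟩ := isPPT_iff.1 hD
  obtain ⟨Q, U, hU, hQ⟩ := isPPT_iff.1 hf
  obtain ⟨R, hR, hR'⟩ := hT.comp hS
  refine isPPT_iff.2 ⟨.comp (.pair .fst Q) P, _,
    ((((polyBdd_tick.add hU).add polyBdd_tick).add hR).add polyBdd_tick), fun κ x => ?_⟩
  have h1 := Runs.fst'.pair_pure (hQ κ x)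
  rw [PMF.pure_map] at h1
  exact h1.comp_pure ((hP κ (f κ x)).mono (hR' _ _ _ (hS' _ _ _ (by simp))))

theorem unif {f : ℕ → Data → ℕ} (hf : PolyNum f) :
    IsPPT fun κ x => (VerFU.unif (f κ x)).map Data.num := by
  have : IsPPT fun _ x => (VerFU.unif x.toNat).map Data.num := by
    refine isPPT_iff.2 ⟨.comp .snd .rand, _, (polyBdd_tick.add polyBdd_tick).add polyBdd_tick,
      fun κ x => Runs.snd'.comp_pure ⟨?_, fun y hy => ?_⟩⟩
    · simp only [Prog.run, PMF.map_comp, Function.comp_def]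
    · simp only [Prog.run, PMF.mem_support_map_iff] at hy
      obtain ⟨k, -, rfl⟩ := hy
      simp only [tick, Data.size]
      omega
  exact this.comp hf

theorem ite_num {c : ℕ → Data → ℕ} (hc : PolyNum c) (h₁ : IsPPT D₁) (h₂ : IsPPT D₂) :
    IsPPT fun κ x => if c κ x = 0 then D₁ κ x else D₂ κ x := by
  obtain ⟨P, T, hT, hP⟩ := isPPT_iff.1 hc
  obtain ⟨P₁, T₁, hT₁, hP₁⟩ := isPPT_iff.1 h₁
  obtain ⟨P₂, T₂, hT₂, hP₂⟩ := isPPT_iff.1 h₂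
  refine isPPT_iff.2 ⟨.ite P P₂ P₁, fun κ x => T κ x + (T₁ κ x + T₂ κ x) + tick (.pair (.num κ) x),
    (hT.add (hT₁.add hT₂)).add polyBdd_tick, fun κ x => ?_⟩
  refine (hP κ x).ite (T' := T₁ κ x + T₂ κ x) ?_
  by_cases h : c κ x = 0
  · rw [if_pos (show Data.toNat (.num (c κ x)) = 0 from h), if_pos h]
    exact (hP₁ κ x).mono (Nat.le_add_right _ _)
  · rw [if_neg (show ¬ Data.toNat (.num (c κ x)) = 0 from h), if_neg h]
    exact (hP₂ κ x).mono (Nat.le_add_left _ _)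

end IsPPT

namespace PolyFun

variable {f g : ℕ → Data → Data}

theorem size_le (hf : PolyFun f) : ∃ S, PolyBdd S ∧ ∀ κ x, (f κ x).size ≤ S κ x := by
  obtain ⟨S, hS, h⟩ := IsPPT.size_le hf
  exact ⟨S, hS, fun κ x => h κ x _ (by simp)⟩

theorem id : PolyFun fun _ x => x :=
  isPPT_iff.2 ⟨.snd, _, polyBdd_tick, fun _ _ => Runs.snd'⟩

theorem param : PolyFun fun κ _ => .num κ :=
  isPPT_iff.2 ⟨.fst, _, polyBdd_tick, fun _ _ => Runs.fst'⟩

theorem of_prog {P : Prog} {g : Data → Data} (h : ∀ x, P.run x = PMF.pure (g x, tick x))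
    (hf : PolyFun f) : PolyFun fun κ x => g (f κ x) := by
  have : IsPPT fun _ x => PMF.pure (g x) :=
    isPPT_iff.2 ⟨.comp .snd P, _, (polyBdd_tick.add polyBdd_tick).add polyBdd_tick, fun κ x =>
      Runs.snd'.comp_pure ((Runs.of_pure (h x)).mono (by simp [tick, Data.size]; omega))⟩
  exact this.comp hf

theorem fst (hf : PolyFun f) : PolyFun fun κ x => (f κ x).fst :=
  hf.of_prog (P := .fst) fun _ => rfl

theorem snd (hf : PolyFun f) : PolyFun fun κ x => (f κ x).snd :=
  hf.of_prog (P := .snd) fun _ => rfl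

theorem pair (hf : PolyFun f) (hg : PolyFun g) : PolyFun fun κ x => .pair (f κ x) (g κ x) := by
  obtain ⟨P, T, hT, hP⟩ := isPPT_iff.1 hf
  obtain ⟨Q, U, hU, hQ⟩ := isPPT_iff.1 hg
  refine isPPT_iff.2 ⟨.pair P Q, _, (hT.add hU).add polyBdd_tick, fun κ x => ?_⟩
  have := (hP κ x).pair_pure (hQ κ x)
  rwa [PMF.pure_map] at this

theorem comp (hf : PolyFun f) (hg : PolyFun g) : PolyFun fun κ x => f κ (g κ x) :=
  IsPPT.comp (D := fun κ y => PMF.pure (f κ y)) hf hg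

theorem ite_num {c : ℕ → Data → ℕ} (hc : PolyNum c) (hf : PolyFun f) (hg : PolyFun g) :
    PolyFun fun κ x => if c κ x = 0 then f κ x else g κ x := by
  have := IsPPT.ite_num hc hf hg
  simp only [← apply_ite] at this
  exact this

theorem num (n : ℕ) : PolyFun fun _ _ => .num n :=
  PolyFun.id.of_prog (P := .const n) (g := fun _ => .num n) fun _ => rfl

theorem const (c : Data) : PolyFun fun _ _ => c := by
  induction c with
  | num n => exact .num n
  | pair a b ha hb => exact ha.pair hb

theorem nth (k : ℕ) (hf : PolyFun f) : PolyFun fun κ x => (f κ x).nth k := by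
  induction k generalizing f with
  | zero => exact hf.fst
  | succ k ih => exact ih hf.snd

theorem list {l : List (ℕ → Data → Data)} (h : ∀ f ∈ l, PolyFun f) :
    PolyFun fun κ x => .list (l.map fun f => f κ x) := by
  induction l with
  | nil => exact .num 0
  | cons f l ih =>
    exact (h f (by simp)).pair (ih fun g hg => h g (by simp [hg]))

theorem vec {n : ℕ} {f : Fin n → ℕ → Data → Data} (h : ∀ i, PolyFun (f i)) :
    PolyFun fun κ x => .vec fun i => f i κ x := by
  have := list (l := List.ofFn f) (by simpa [List.mem_ofFn] using h)
  simpa [List.map_ofFn, Data.vec, Function.comp_def] using this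

theorem listNil : PolyFun fun _ _ => .list [] := .num 0

theorem listCons {l : ℕ → Data → List Data} (hf : PolyFun f) (hl : PolyFun fun κ x => .list (l κ x)) :
    PolyFun fun κ x => .list (f κ x :: l κ x) := hf.pair hl

/-- The condition depends neither on `κ` nor on the input (such as membership in `users t` for a
fixed round), so it is decided when the program is chosen, not when it runs. -/
theorem ite_prop (p : Prop) [Decidable p] (hf : PolyFun f) (hg : PolyFun g) :
    PolyFun fun κ x => if p then f κ x else g κ x := by
  split_ifs <;> assumption

end PolyFun

namespace PolyNum

variable {f g c : ℕ → Data → ℕ}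

theorem num_fun (hf : PolyNum f) : PolyFun fun κ x => .num (f κ x) := hf

theorem const (n : ℕ) : PolyNum fun _ _ => n := PolyFun.num n

theorem param : PolyNum fun κ _ => κ := PolyFun.param

theorem arith (o : Op) (hf : PolyNum f) (hg : PolyNum g) :
    PolyNum fun κ x => o.eval (f κ x) (g κ x) :=
  (PolyFun.pair hf hg).of_prog (P := .arith o) fun _ => rfl

theorem add (hf : PolyNum f) (hg : PolyNum g) : PolyNum fun κ x => f κ x + g κ x := hf.arith .add hg

theorem sub (hf : PolyNum f) (hg : PolyNum g) : PolyNum fun κ x => f κ x - g κ x := hf.arith .sub hg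

theorem mul (hf : PolyNum f) (hg : PolyNum g) : PolyNum fun κ x => f κ x * g κ x := hf.arith .mul hg

theorem div (hf : PolyNum f) (hg : PolyNum g) : PolyNum fun κ x => f κ x / g κ x := hf.arith .div hg

theorem mod (hf : PolyNum f) (hg : PolyNum g) : PolyNum fun κ x => f κ x % g κ x := hf.arith .mod hg

theorem toNat {f : ℕ → Data → Data} (hf : PolyFun f) : PolyNum fun κ x => (f κ x).toNat :=
  (PolyFun.pair hf (.num 0)).of_prog (P := .arith .add) fun _ => rfl

theorem natSize (hf : PolyNum f) : PolyNum fun κ x => Nat.size (f κ x) :=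
  PolyFun.of_prog (P := .len) (fun _ => rfl) hf

theorem ite_num (hc : PolyNum c) (hf : PolyNum f) (hg : PolyNum g) :
    PolyNum fun κ x => if c κ x = 0 then f κ x else g κ x := by
  have := PolyFun.ite_num hc hf hg
  simp only [← apply_ite] at this
  exact this

theorem ite_le {a b : ℕ → Data → ℕ} (ha : PolyNum a) (hb : PolyNum b) (hf : PolyNum f)
    (hg : PolyNum g) : PolyNum fun κ x => if a κ x ≤ b κ x then f κ x else g κ x := by
  simpa only [Nat.sub_eq_zero_iff_le] using ite_num (ha.sub hb) hf hg

theorem ite_prop (p : Prop) [Decidable p] (hf : PolyNum f) (hg : PolyNum g) :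
    PolyNum fun κ x => if p then f κ x else g κ x := by
  split_ifs <;> assumption

theorem sum {ι : Type*} (s : Finset ι) {f : ι → ℕ → Data → ℕ} (h : ∀ i, PolyNum (f i)) :
    PolyNum fun κ x => ∑ i ∈ s, f i κ x := by
  classical
  induction s using Finset.induction_on with
  | empty => simpa using const 0
  | insert i s hi ih => simpa [Finset.sum_insert hi] using (h i).add ih

theorem size_le (hf : PolyNum f) : ∃ S, PolyBdd S ∧ ∀ κ x, Nat.size (f κ x) ≤ S κ x := by
  obtain ⟨S, hS, h⟩ := PolyFun.size_le hf
  exact ⟨S, hS, fun κ x => (Nat.le_succ _).trans (h κ x)⟩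

theorem polynomial_eval (p : Polynomial ℕ) : PolyNum fun κ _ => p.eval κ := by
  induction p using Polynomial.induction_on' with
  | add p r hp hr => simpa using hp.add hr
  | monomial n a =>
    simp only [Polynomial.eval_monomial]
    refine (const a).mul ?_
    induction n with
    | zero => simpa using const 1
    | succ n ih => simpa [pow_succ] using ih.mul param

end PolyNum

/-! ### Loops and samples -/

/-- A loop whose number of iterations and intermediate results are polynomially bounded. -/
theorem PolyFun.iterate {step : ℕ → Data → Data → Data} {init : ℕ → Data → Data}
    {count : ℕ → Data → ℕ} {B S : ℕ → Data → ℕ}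
    (hstep : PolyFun fun κ z => step κ z.fst z.snd) (hinit : PolyFun init)
    (hcount : PolyNum count) (hB : PolyBdd B) (hcB : ∀ κ x, count κ x ≤ B κ x) (hS : PolyBdd S)
    (hsize : ∀ κ x, ∀ k ≤ count κ x, ((step κ x)^[k] (init κ x)).size ≤ S κ x) :
    PolyFun fun κ x => (step κ x)^[count κ x] (init κ x) := by
  obtain ⟨P, T, hT, hP⟩ := isPPT_iff.1 hstep
  obtain ⟨R, hR, hR'⟩ := hT.comp ((PolyBdd.size.add hS).add (PolyBdd.const 1))
  -- A loop body sees nothing but its state, so `κ` and `x` are carried along in the state and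
  -- copied in each iteration.
  have hpre : PolyFun fun κ x => .pair (.num (count κ x))
      (.pair (.num κ) (.pair x (init κ x))) :=
    hcount.num_fun.pair (PolyFun.param.pair (PolyFun.id.pair hinit))
  obtain ⟨Q, U, hU, hQ⟩ := isPPT_iff.1 hpre
  have ht : PolyBdd fun κ x => κ + x.size + S κ x + 10 :=
    (((PolyBdd.param.add .size).add hS).add (.const 10))
  have key : ∀ κ x, Runs (.comp Q (.comp (.loop (.pair .fst (.pair (.comp .snd .fst) P)))
      (.comp .snd .snd))) (.pair (.num κ) x)
      (PMF.pure ((step κ x)^[count κ x] (init κ x)))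
      (U κ x + ((B κ x + (κ + x.size + S κ x + 10)) + B κ x * (6 * (κ + x.size + S κ x + 10) +
        R κ x + 1) +
        3 * (κ + x.size + S κ x + 10) + (B κ x + (κ + x.size + S κ x + 10))) +
        tick (.pair (.num κ) x)) := by
    intro κ x
    set n := count κ x with hn
    set s : ℕ → Data := fun k => .pair (.num κ) (.pair x ((step κ x)^[k] (init κ x))) with hs
    set τ := κ + x.size + S κ x + 10 with hτ
    have htick : ∀ k ≤ n, tick (s k) ≤ τ := fun k hk => by
      have h1 := hsize κ x k hk
      have h2 := natSize_le_self κ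
      simp only [hs, tick, Data.size]
      omega
    have hbody : ∀ k < n, Runs (.pair .fst (.pair (.comp .snd .fst) P)) (s k)
        (PMF.pure (s (k + 1))) (6 * τ + R κ x) := by
      intro k hk
      have h1 : Runs (.comp .snd .fst) (s k) (PMF.pure x) (3 * τ) := by
        have : Runs .fst (Data.pair x ((step κ x)^[k] (init κ x))) (PMF.pure x) τ :=
          (Runs.of_pure rfl).mono (le_trans (by simp [hs, tick, Data.size]; omega) (htick k hk.le))
        exact ((Runs.snd' (κ := κ)).comp_pure this).mono (by
          have h : tick (.pair (.num κ) (.pair x ((step κ x)^[k] (init κ x)))) ≤ τ := htick k hk.le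
          omega)
      have h2 : Runs P (s k) (PMF.pure ((step κ x)^[k + 1] (init κ x))) (R κ x) := by
        rw [Function.iterate_succ_apply']
        refine (hP κ (.pair x ((step κ x)^[k] (init κ x)))).mono (hR' _ _ _ ?_)
        have h1 := hsize κ x k hk.le
        simp only [Data.size]
        omega
      have h3 := h1.pair_pure h2
      have h4 := (Runs.fst' (κ := κ) (x := .pair x ((step κ x)^[k] (init κ x)))).pair_pure h3
      simp only [PMF.pure_map] at h4
      refine h4.mono ?_
      have := htick k hk.le
      simp only [hs] at this ⊢
      omega
    have hloop := Runs.loop hbody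
    have hpost : Runs (.comp .snd .snd) (s n) (PMF.pure ((step κ x)^[n] (init κ x))) (3 * τ) := by
      have h1 : Runs .snd (Data.pair x ((step κ x)^[n] (init κ x)))
          (PMF.pure ((step κ x)^[n] (init κ x))) τ :=
        (Runs.of_pure rfl).mono (le_trans (by simp [hs, tick, Data.size]; omega) (htick n le_rfl))
      exact ((Runs.snd' (κ := κ)).comp_pure h1).mono (by
        have h : tick (.pair (.num κ) (.pair x ((step κ x)^[n] (init κ x)))) ≤ τ := htick n le_rfl
        omega)
    have hall := (hQ κ x).comp_pure (hloop.comp_pure hpost)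
    refine hall.mono ?_
    have hnB : n ≤ B κ x := hcB κ x
    have hm := Nat.mul_le_mul_right (6 * τ + R κ x + 1) hnB
    have ht0 : tick (.pair (.num n) (s 0)) ≤ B κ x + τ := by
      have h1 := hsize κ x 0 (Nat.zero_le _)
      have h2 := natSize_le_self κ
      have h3 := natSize_le_self n
      simp only [hs, tick, Data.size]
      omega
    omega
  refine isPPT_iff.2 ⟨_, _, ?_, key⟩
  exact (hU.add ((((hB.add ht).add (hB.mul ((((PolyBdd.const 6).mul ht).add hR).add
    (.const 1)))).add ((PolyBdd.const 3).mul ht)).add (hB.add ht))).add polyBdd_tick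

theorem IsPPT.bind_tuple {n : ℕ} {D : Fin n → ℕ → Data → PMF Data}
    {E : ℕ → Data → (Fin n → Data) → PMF Data} (hD : ∀ i, IsPPT (D i))
    (hE : IsPPT fun κ z => E κ z.fst fun i => z.snd.nth i) :
    IsPPT fun κ x => (tuple fun i => D i κ x).bind (E κ x) := by
  induction n with
  | zero =>
    have : IsPPT fun κ x => E κ x fun i => (Data.num 0).nth i :=
      hE.comp (f := fun _ x => .pair x (.num 0)) (PolyFun.id.pair (.num 0))
    convert this using 3
    simp only [tuple, PMF.pure_bind]
    congr 1
    exact Subsingleton.elim _ _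
  | succ n ih =>
    -- The first sample is moved into the input, which gives the induction hypothesis a continuation
    -- for the remaining samples.
    have h1 : IsPPT fun κ z => (tuple fun i : Fin n => D i.succ κ z.fst).bind
        fun xs => E κ z.fst (Fin.cons z.snd xs) := by
      refine ih (D := fun i κ z => D i.succ κ z.fst)
        (E := fun κ z xs => E κ z.fst (Fin.cons z.snd xs)) (fun i => (hD _).comp PolyFun.id.fst) ?_
      have := hE.comp (f := fun _ w => .pair w.fst.fst (.pair w.fst.snd w.snd))
        (PolyFun.id.fst.fst.pair (PolyFun.id.fst.snd.pair PolyFun.id.snd))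
      have hc : ∀ w : Data, (Fin.cons w.fst.snd fun i : Fin n => w.snd.nth i) =
          fun i : Fin (n + 1) => (Data.pair w.fst.snd w.snd).nth i := fun w => by
        funext i
        refine Fin.cases ?_ (fun i => ?_) i <;> simp [Data.nth, Data.fst, Data.snd]
      have hE' : ∀ κ (w : Data), E κ w.fst.fst (Fin.cons w.fst.snd fun i : Fin n => w.snd.nth i) =
          E κ w.fst.fst fun i : Fin (n + 1) => (Data.pair w.fst.snd w.snd).nth i := fun κ (w : Data) => by
        rw [hc]
      exact (funext₂ hE').symm ▸ this
    have h2 := (hD 0).bind (E := fun κ x a => (tuple fun i : Fin n => D i.succ κ x).bind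
        fun xs => E κ x (Fin.cons a xs)) h1
    simpa only [tuple, Bind.bind, PMF.bind_bind, PMF.pure_bind] using h2

theorem IsPPT.map_tuple {n : ℕ} {D : Fin n → ℕ → Data → PMF Data}
    {f : ℕ → Data → (Fin n → Data) → Data} (hD : ∀ i, IsPPT (D i))
    (hf : PolyFun fun κ z => f κ z.fst fun i => z.snd.nth i) :
    IsPPT fun κ x => (tuple fun i => D i κ x).map (f κ x) :=
  IsPPT.bind_tuple (E := fun κ x xs => PMF.pure (f κ x xs)) hD hf

/-! ### Expectations and domination of experiments -/

/-- The expectation of a nonnegative function. -/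
def expect {α : Type} (μ : PMF α) (f : α → ℝ≥0∞) : ℝ≥0∞ := ∑' a, μ a * f a

section expect

variable {α β γ : Type} {μ : PMF α} {f g : α → ℝ≥0∞}

theorem expect_pure (a : α) (f : α → ℝ≥0∞) : expect (PMF.pure a) f = f a := by
  rw [expect, tsum_eq_single a]
  · simp
  · intro b hb
    simp [PMF.pure_apply, hb]

theorem expect_bind (μ : PMF α) (k : α → PMF β) (f : β → ℝ≥0∞) :
    expect (μ.bind k) f = expect μ fun a => expect (k a) f := by
  simp only [expect, PMF.bind_apply, ← ENNReal.tsum_mul_right, ← ENNReal.tsum_mul_left]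
  rw [ENNReal.tsum_comm]
  simp only [mul_assoc]

theorem expect_map (μ : PMF α) (e : α → β) (f : β → ℝ≥0∞) :
    expect (μ.map e) f = expect μ fun a => f (e a) := by
  rw [PMF.map, expect_bind]
  simp [expect_pure]

theorem expect_mono_support (h : ∀ a ∈ μ.support, f a ≤ g a) : expect μ f ≤ expect μ g := by
  refine ENNReal.tsum_le_tsum fun a => ?_
  by_cases ha : μ a = 0
  · simp [ha]
  · exact mul_le_mul_right (h a ((PMF.mem_support_iff _ _).2 ha)) _

theorem expect_mono (h : ∀ a, f a ≤ g a) : expect μ f ≤ expect μ g :=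
  expect_mono_support fun a _ => h a

theorem expect_add (μ : PMF α) (f g : α → ℝ≥0∞) :
    expect μ (fun a => f a + g a) = expect μ f + expect μ g := by
  simp only [expect, mul_add, ENNReal.tsum_add]

theorem expect_const_mul (μ : PMF α) (c : ℝ≥0∞) (f : α → ℝ≥0∞) :
    expect μ (fun a => c * f a) = c * expect μ f := by
  simp only [expect, ← ENNReal.tsum_mul_left]
  exact tsum_congr fun a => by ring

theorem expect_sum {ι : Type*} (s : Finset ι) (μ : PMF α) (f : ι → α → ℝ≥0∞) :
    expect μ (fun a => ∑ i ∈ s, f i a) = ∑ i ∈ s, expect μ (f i) := by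
  classical
  induction s using Finset.induction_on with
  | empty => simp [expect]
  | insert i s hi ih => simp [Finset.sum_insert hi, expect_add, ih]

theorem expect_const (μ : PMF α) (c : ℝ≥0∞) : expect μ (fun _ => c) = c := by
  simp [expect, ENNReal.tsum_mul_right, PMF.tsum_coe]

theorem expect_comm (μ : PMF α) (ν : PMF β) (f : α → β → ℝ≥0∞) :
    expect μ (fun a => expect ν (f a)) = expect ν fun b => expect μ fun a => f a b := by
  simp only [expect, ← ENNReal.tsum_mul_left]
  rw [ENNReal.tsum_comm]
  simp only [mul_left_comm]

end expect

/-- The indicator of a statement. -/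
def ind (p : Prop) : ℝ≥0∞ := open Classical in if p then 1 else 0

theorem ind_mono {p r : Prop} (h : p → r) : ind p ≤ ind r := by
  unfold ind
  split_ifs <;> simp_all

theorem ind_le_one (p : Prop) : ind p ≤ 1 := by
  unfold ind
  split_ifs <;> simp

theorem ind_of_not {p : Prop} (h : ¬ p) : ind p = 0 := if_neg h

theorem ind_of {p : Prop} (h : p) : ind p = 1 := if_pos h

theorem ind_or_le (p r : Prop) : ind (p ∨ r) ≤ ind p + ind r := by
  by_cases hp : p
  · exact (ind_le_one _).trans (by simp [ind_of hp])
  · simp [hp]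

theorem ind_exists_le {n : ℕ} (p : Fin n → Prop) : ind (∃ i, p i) ≤ ∑ i, ind (p i) := by
  by_cases h : ∃ i, p i
  · obtain ⟨i, hi⟩ := h
    calc ind (∃ i, p i) ≤ ind (p i) := ind_mono fun _ => hi
      _ ≤ _ := Finset.single_le_sum (f := fun i => ind (p i)) (fun _ _ => zero_le) (Finset.mem_univ i)
  · simp [ind_of_not h]

theorem apply_true_eq (μ : PMF Prop) : μ True = expect μ ind := by
  rw [expect, tsum_eq_single True]
  · simp [ind]
  · intro p hp
    have : ¬ p := fun h => hp (eq_true h)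
    simp [ind, this]

/-- Expectations over `μ` are at most `C` times those over `ν`, for functions that respect the
relation `R` of the outcomes. -/
def Dom {α β : Type} (C : ℝ≥0∞) (R : α → β → Prop) (μ : PMF α) (ν : PMF β) : Prop :=
  ∀ (f : α → ℝ≥0∞) (g : β → ℝ≥0∞), (∀ a b, R a b → f a ≤ g b) → expect μ f ≤ C * expect ν g

namespace Dom

variable {α β γ δ : Type} {C C' : ℝ≥0∞} {R : α → β → Prop} {R' : γ → δ → Prop}
  {μ : PMF α} {ν : PMF β}

theorem pure {a : α} {b : β} (h : R a b) : Dom 1 R (PMF.pure a) (PMF.pure b) := fun f g hfg => by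
  simpa [expect_pure] using hfg a b h

theorem weaken {S : α → β → Prop} (h : Dom C R μ ν) (hS : ∀ a b, R a b → S a b) : Dom C S μ ν :=
  fun f g hfg => h f g fun a b hab => hfg a b (hS a b hab)

/-- The inner expectations, the second one multiplied by `C'`, are again functions that respect `R`;
so the constants of successive stages multiply. -/
theorem bind {k : α → PMF γ} {l : β → PMF δ} (h : Dom C R μ ν)
    (hk : ∀ a b, R a b → Dom C' R' (k a) (l b)) : Dom (C * C') R' (μ.bind k) (ν.bind l) := by
  intro f g hfg
  rw [expect_bind, expect_bind, mul_assoc, ← expect_const_mul]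
  exact h _ _ fun a b hab => hk a b hab f g hfg

theorem bind_one {k : α → PMF γ} {l : β → PMF δ} (h : Dom 1 R μ ν)
    (hk : ∀ a b, R a b → Dom C R' (k a) (l b)) : Dom C R' (μ.bind k) (ν.bind l) := by
  simpa using h.bind hk

theorem refl (μ : PMF α) : Dom 1 Eq μ μ := fun f g hfg => by
  rw [one_mul]
  exact expect_mono fun a => hfg a a rfl

theorem of_eq {μ' : PMF α} (h : μ = μ') : Dom 1 Eq μ μ' := h ▸ refl μ

theorem of_le {μ' : PMF α} (h : ∀ a, μ a ≤ C * μ' a) : Dom C Eq μ μ' := fun f g hfg => by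
  rw [← expect_const_mul]
  refine ENNReal.tsum_le_tsum fun a => ?_
  calc μ a * f a ≤ C * μ' a * g a := mul_le_mul' (h a) (hfg a a rfl)
    _ = _ := by ring

/-- Replacing `f` by zero off the support of `μ` does not change its expectation, so related
outcomes of `μ` may be assumed possible. -/
theorem support (h : Dom C R μ ν) : Dom C (fun a b => R a b ∧ a ∈ μ.support) μ ν := by
  classical
  intro f g hfg
  refine le_trans ?_ (h (fun a => if a ∈ μ.support then f a else 0) g ?_)
  · exact expect_mono_support fun a ha => by rw [if_pos ha]
  · intro a b hab
    split_ifs with ha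
    · exact hfg a b ⟨hab, ha⟩
    · exact zero_le

theorem tuple {n : ℕ} {p : Fin n → PMF α} {r : Fin n → PMF β} {R : Fin n → α → β → Prop}
    (h : ∀ i, Dom C (R i) (p i) (r i)) :
    Dom (C ^ n) (fun x y => ∀ i, R i (x i) (y i)) (VerFU.tuple p) (VerFU.tuple r) := by
  induction n with
  | zero =>
    rw [pow_zero]
    exact Dom.pure fun i : Fin 0 => i.elim0
  | succ n ih =>
    simp only [VerFU.tuple, Bind.bind]
    rw [pow_succ']
    refine (h 0).bind fun a b hab => ?_
    rw [← mul_one (C ^ n)]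
    refine (ih fun i => h i.succ).bind fun x y hxy => Dom.pure fun i => ?_
    refine Fin.cases ?_ (fun i => ?_) i
    · simpa using hab
    · simpa using hxy i

end Dom

/-! ### Samples -/

theorem unifOn_apply {α : Type} [Inhabited α] {s : Finset α} (hs : s.Nonempty) (a : α)
    [Decidable (a ∈ s)] : unifOn s a = if a ∈ s then (s.card : ℝ≥0∞)⁻¹ else 0 := by
  unfold unifOn
  rw [dif_pos hs, PMF.uniformOfFinset_apply]
  congr

/-- The ratio `φ(p q) / (p q) = (1 - 1/p) (1 - 1/q)` is smallest for the primes `2` and `3`, where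
it is `1/3`. -/
theorem mul_le_three_mul_totient {p q : ℕ} (hp : p.Prime) (hq : q.Prime) (hpq : p ≠ q) :
    p * q ≤ 3 * Nat.totient (p * q) := by
  rw [Nat.totient_mul ((Nat.coprime_primes hp hq).2 hpq), Nat.totient_prime hp,
    Nat.totient_prime hq]
  have h2 := hp.two_le
  have h3 := hq.two_le
  obtain ⟨a, rfl⟩ : ∃ a, p = a + 2 := ⟨p - 2, by omega⟩
  obtain ⟨b, rfl⟩ : ∃ b, q = b + 2 := ⟨q - 2, by omega⟩
  -- The goal amounts to `1 ≤ 2 a b + a + b`, which fails only for `a = b = 0`, that is, for `p = q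
  -- = 2`.
  have h4 : 1 ≤ a + b := by omega
  simp only [show a + 2 - 1 = a + 1 by omega, show b + 2 - 1 = b + 1 by omega]
  nlinarith

/-- Uniform residues prime to `p q` are dominated by uniform residues. -/
theorem dom_coprime {p q : ℕ} (hp : p.Prime) (hq : q.Prime) (hpq : p ≠ q) :
    Dom 3 (fun a b => a = b ∧ Nat.Coprime (p * q) a)
      (unifOn ((Finset.range (p * q)).filter (Nat.Coprime (p * q)))) (unif (p * q)) := by
  have hn : 0 < p * q := Nat.mul_pos hp.pos hq.pos
  have ht : 0 < Nat.totient (p * q) := Nat.totient_pos.2 hn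
  have hs : ((Finset.range (p * q)).filter (Nat.Coprime (p * q))).Nonempty := by
    rw [← Finset.card_pos]
    exact ht
  have hr : (Finset.range (p * q)).Nonempty := ⟨0, by simpa using hn⟩
  have key : Dom 3 Eq (unifOn ((Finset.range (p * q)).filter (Nat.Coprime (p * q))))
      (unif (p * q)) := by
    refine Dom.of_le fun a => ?_
    rw [unif, unifOn_apply hs, unifOn_apply hr, ← Nat.totient_eq_card_coprime]
    split_ifs with h1 h2
    · rw [Finset.card_range, ← div_eq_mul_inv, ENNReal.le_div_iff_mul_le (by simp)
        (by simp), mul_comm, ← div_eq_mul_inv]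
      refine ENNReal.div_le_of_le_mul ?_
      exact_mod_cast mul_le_three_mul_totient hp hq hpq
    · exact absurd (Finset.mem_filter.1 h1).1 h2
    · exact zero_le
    · exact zero_le
  refine key.support.weaken fun a b hab => ⟨hab.1, ?_⟩
  classical
  have h := (PMF.mem_support_iff _ _).1 hab.2
  rw [unifOn_apply hs] at h
  by_contra hc
  exact h (if_neg fun hm => hc (Finset.mem_filter.1 hm).2)

/-- One component of independent samples may be drawn first. -/
theorem tuple_update {α : Type} {n : ℕ} (p : Fin n → PMF α) (k : Fin n) :
    ((p k).bind fun x => (tuple p).bind fun xs => PMF.pure (Function.update xs k x)) = tuple p := by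
  induction n with
  | zero => exact k.elim0
  | succ n ih =>
    refine Fin.cases ?_ (fun k => ?_) k
    · simp only [tuple, Bind.bind, PMF.bind_bind, PMF.pure_bind, Fin.update_cons_zero,
        PMF.bind_const]
    · simp only [tuple, Bind.bind, PMF.bind_bind, PMF.pure_bind, ← Fin.cons_update]
      rw [PMF.bind_comm]
      congr 1
      funext x
      have := ih (fun i => p i.succ) k
      conv_rhs => rw [← this]
      simp only [PMF.bind_bind, PMF.pure_bind]

theorem tuple_map {α β : Type} {n : ℕ} (p : Fin n → PMF α) (e : Fin n → α → β) :
    tuple (fun i => (p i).map (e i)) = (tuple p).map fun x i => e i (x i) := by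
  induction n with
  | zero =>
    simp only [tuple, PMF.pure_map]
    congr 1
    exact Subsingleton.elim _ _
  | succ n ih =>
    simp only [tuple, Bind.bind, PMF.map_bind, PMF.pure_map, PMF.bind_map, Function.comp_def,
      ih fun i => p i.succ]
    congr 1
    funext x
    congr 1
    funext xs
    congr 1
    funext i
    refine Fin.cases ?_ (fun i => ?_) i <;> simp

/-! ### Correctness of the Paillier cryptosystem -/

namespace PaillierKey

variable {K : PaillierKey}

theorem Valid.one_lt (h : K.Valid) : 1 < K.n := by
  have h1 := h.1.two_le
  have h2 := h.2.1.two_le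
  unfold n
  nlinarith

theorem Valid.neZero (h : K.Valid) : NeZero K.n := ⟨(zero_lt_one.trans h.one_lt).ne'⟩

/-- The discrete logarithm to the base `1 + n` of the power of `c`. -/
theorem Valid.pow_lam (h : K.Valid) {c : K.Cipher} (hc : IsUnit c) :
    ∃ l : ℕ, l < K.n ∧ c ^ K.lam = ((1 + K.n * l : ℕ) : K.Cipher) := by
  have := h.neZero
  have h1 := h.one_lt
  have hn2 : NeZero (K.n ^ 2) := ⟨pow_ne_zero _ (NeZero.ne _)⟩
  have hdvd : K.n ∣ K.n ^ 2 := dvd_pow_self _ two_ne_zero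
  -- Fermat's theorem modulo each prime factor, since `lam` is a multiple of `p - 1` and of `q - 1`.
  -- The two congruences combine to `c ^ lam ≡ 1` modulo `n`.
  have hprime : ∀ r : ℕ, r.Prime → r ∣ K.n → (r - 1) ∣ K.lam →
      (r : ℤ) ∣ ((c ^ K.lam).val : ℤ) - 1 := by
    intro r hr hrn hl
    have : Fact r.Prime := ⟨hr⟩
    have hrd : r ∣ K.n ^ 2 := hrn.trans hdvd
    set φ := ZMod.castHom hrd (ZMod r) with hφ
    have hu : φ c ≠ 0 := (hc.map φ).ne_zero
    have e1 : φ (c ^ K.lam) = 1 := by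
      obtain ⟨m, hm⟩ := hl
      rw [map_pow, hm, pow_mul, ZMod.pow_card_sub_one_eq_one hu, one_pow]
    have e2 : φ (c ^ K.lam) = (((c ^ K.lam).val : ℕ) : ZMod r) := by
      rw [hφ, ZMod.castHom_apply, ZMod.natCast_val]
    rw [← ZMod.intCast_zmod_eq_zero_iff_dvd] at *
    push_cast
    rw [e1] at e2
    rw [← e2, sub_self]
  have hp := hprime K.p h.1 (dvd_mul_right _ _) (Nat.dvd_lcm_left _ _)
  have hq := hprime K.q h.2.1 (dvd_mul_left _ _) (Nat.dvd_lcm_right _ _)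
  have hcop : IsCoprime (K.p : ℤ) (K.q : ℤ) :=
    Nat.isCoprime_iff_coprime.2 ((Nat.coprime_primes h.1 h.2.1).2 h.2.2.1)
  have hpq : (K.n : ℤ) ∣ ((c ^ K.lam).val : ℤ) - 1 := by
    unfold n
    push_cast
    exact hcop.mul_dvd hp hq
  have hv : (c ^ K.lam).val < K.n ^ 2 := ZMod.val_lt _
  -- The representative cannot be `0`, as `n > 1` does not divide `-1`; hence the subtraction of
  -- natural numbers below is not truncated.
  have hv1 : 1 ≤ (c ^ K.lam).val := by
    rw [Nat.one_le_iff_ne_zero]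
    intro h0
    rw [h0] at hpq
    have := Int.le_of_dvd one_pos (by simpa using hpq)
    omega
  obtain ⟨l, hl⟩ : K.n ∣ (c ^ K.lam).val - 1 := by
    rw [← Int.natCast_dvd_natCast]
    push_cast [hv1]
    exact hpq
  have hl' : (c ^ K.lam).val = 1 + K.n * l := by omega
  refine ⟨l, ?_, ?_⟩
  · have : K.n * l < K.n * K.n := by
      rw [← sq]
      omega
    exact Nat.lt_of_mul_lt_mul_left this
  · rw [← hl', ZMod.natCast_val, ZMod.cast_id]

/-- Modulo `n ^ 2` only the residue of `l` modulo `n` matters, and `1 + n * (l % n)` is already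
reduced because `1 < n`. -/
theorem L_natCast (h : 1 < K.n) (l : ℕ) :
    K.L ((1 + K.n * l : ℕ) : K.Cipher) = (l : K.Plain) := by
  have hn0 : 0 < K.n := zero_lt_one.trans h
  unfold L
  rw [ZMod.val_natCast]
  have h1 : (1 + K.n * l) % K.n ^ 2 = 1 + K.n * (l % K.n) := by
    rw [← Nat.mod_add_div l K.n, sq]
    have h2 : l % K.n < K.n := Nat.mod_lt _ hn0
    have h3 : 1 + K.n * (l % K.n) < K.n * K.n := by nlinarith
    rw [show 1 + K.n * (l % K.n + K.n * (l / K.n)) = 1 + K.n * (l % K.n) + K.n * K.n * (l / K.n) by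
      ring, Nat.add_mul_mod_self_left, Nat.mod_eq_of_lt h3]
    simp
  rw [h1, Nat.add_sub_cancel_left, Nat.mul_div_cancel_left _ hn0, ZMod.natCast_mod]

/-- The function `L (c ^ lam)`. -/
def logL (K : PaillierKey) (c : K.Cipher) : K.Plain := K.L (c ^ K.lam)

/-- Since `n ^ 2 = 0` in the ciphertext ring, `(1 + n l) (1 + n l') = 1 + n (l + l')`. So `logL` is
a homomorphism from the units to the additive group of plaintexts, from which the homomorphic
properties of the cryptosystem follow. -/
theorem Valid.logL_mul (h : K.Valid) {c c' : K.Cipher} (hc : IsUnit c) (hc' : IsUnit c') :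
    K.logL (c * c') = K.logL c + K.logL c' := by
  obtain ⟨l, -, hl⟩ := h.pow_lam hc
  obtain ⟨l', -, hl'⟩ := h.pow_lam hc'
  have hn : ((K.n : K.Cipher)) ^ 2 = 0 := by
    rw [← Nat.cast_pow, ZMod.natCast_self]
  have : (c * c') ^ K.lam = ((1 + K.n * (l + l') : ℕ) : K.Cipher) := by
    rw [mul_pow, hl, hl']
    push_cast
    linear_combination (l * l' : K.Cipher) * hn
  unfold logL
  rw [this, hl, hl', L_natCast h.one_lt, L_natCast h.one_lt, L_natCast h.one_lt]
  push_cast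
  rfl

theorem Valid.logL_one (h : K.Valid) : K.logL 1 = 0 := by
  have := h.logL_mul isUnit_one isUnit_one
  rw [mul_one] at this
  simpa using this

theorem Valid.logL_inv (h : K.Valid) {c : K.Cipher} (hc : IsUnit c) :
    K.logL c⁻¹ = -K.logL c := by
  have hi : c * c⁻¹ = 1 := ZMod.mul_inv_of_unit _ hc
  have h1 := h.logL_mul hc (IsUnit.of_mul_eq_one c (by rw [mul_comm, hi]))
  rw [hi, h.logL_one] at h1
  linear_combination -h1

theorem Valid.logL_pow (h : K.Valid) {c : K.Cipher} (hc : IsUnit c) (m : ℕ) :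
    K.logL (c ^ m) = m * K.logL c := by
  induction m with
  | zero => simp [h.logL_one]
  | succ m ih =>
    rw [pow_succ, h.logL_mul (hc.pow m) hc, ih]
    push_cast
    ring

theorem Valid.isUnit_prod (_ : K.Valid) {ι : Type*} (s : Finset ι) {c : ι → K.Cipher}
    (hc : ∀ i, IsUnit (c i)) : IsUnit (∏ i ∈ s, c i) := by
  classical
  induction s using Finset.induction_on with
  | empty => simp
  | insert i s hi ih =>
    rw [Finset.prod_insert hi]
    exact (hc i).mul ih

theorem Valid.logL_prod (h : K.Valid) {ι : Type*} (s : Finset ι) {c : ι → K.Cipher}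
    (hc : ∀ i, IsUnit (c i)) : K.logL (∏ i ∈ s, c i) = ∑ i ∈ s, K.logL (c i) := by
  classical
  induction s using Finset.induction_on with
  | empty => simp [h.logL_one]
  | insert i s hi ih =>
    rw [Finset.prod_insert hi, Finset.sum_insert hi, h.logL_mul (hc i) (h.isUnit_prod s hc), ih]

/-- A ciphertext of `c`: a possible outcome of the encryption. -/
def IsEncryption (K : PaillierKey) (c : K.Plain) (x : K.Cipher) : Prop :=
  ∃ r : ℕ, Nat.Coprime K.n r ∧ x = (K.g : K.Cipher) ^ c.val * (r : K.Cipher) ^ K.n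

theorem Valid.isUnit_of_coprime (_ : K.Valid) {r : ℕ} (hr : Nat.Coprime K.n r) :
    IsUnit (r : K.Cipher) := by
  rw [ZMod.isUnit_iff_coprime]
  exact (hr.pow_left 2).symm

theorem Valid.isUnit_encryption (h : K.Valid) {c : K.Plain} {x : K.Cipher}
    (hx : K.IsEncryption c x) : IsUnit x := by
  obtain ⟨r, hr, rfl⟩ := hx
  exact (h.2.2.2.2.1.pow _).mul ((h.isUnit_of_coprime hr).pow _)

/-- The blinding factor `r ^ n` contributes `n * logL r`, which vanishes modulo `n`. -/
theorem Valid.logL_encryption (h : K.Valid) {c : K.Plain} {x : K.Cipher}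
    (hx : K.IsEncryption c x) : K.logL x = c * K.logL K.g := by
  have := h.neZero
  obtain ⟨r, hr, rfl⟩ := hx
  have hu := h.isUnit_of_coprime hr
  rw [h.logL_mul (h.2.2.2.2.1.pow _) (hu.pow _), h.logL_pow h.2.2.2.2.1, h.logL_pow hu]
  simp

/-- The logarithm of the aggregate is the signed sum of the plaintexts times `logL g`, and `mu` is
the inverse of the latter. -/
theorem Valid.decrypt_aggregate (h : K.Valid) {N : ℕ} (U V : Finset (Fin N))
    {c : Fin N → K.Plain} {x : Fin N → K.Cipher} (hx : ∀ i, K.IsEncryption (c i) (x i)) :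
    K.decrypt ((∏ i ∈ U, x i) * (∏ j ∈ V, x j)⁻¹) = ∑ i ∈ U, c i - ∑ j ∈ V, c j := by
  have hu : ∀ i, IsUnit (x i) := fun i => h.isUnit_encryption (hx i)
  have hV := h.isUnit_prod V hu
  have hVi : IsUnit (∏ j ∈ V, x j)⁻¹ :=
    IsUnit.of_mul_eq_one _ (ZMod.inv_mul_of_unit _ hV)
  have hmu : K.logL K.g * K.mu = 1 := ZMod.mul_inv_of_unit _ h.2.2.2.2.2
  change K.logL _ * K.mu = _
  rw [h.logL_mul (h.isUnit_prod U hu) hVi, h.logL_inv hV, h.logL_prod U hu, h.logL_prod V hu]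
  simp only [fun i => h.logL_encryption (hx i), ← Finset.sum_mul]
  linear_combination (∑ i ∈ U, c i - ∑ j ∈ V, c j) * hmu

/-- Decoding an aggregate of at most `N` encoded numbers. -/
theorem decode_sum {q N : ℕ} [NeZero q] (hn : N * q < K.n) {U V : Finset (Fin N)}
    (hUV : Disjoint U V) (x : Fin N → ZMod q) :
    (K.decode (∑ i ∈ U, K.encode (x i) - ∑ j ∈ V, K.encode (x j)) : ZMod q) =
      ∑ i ∈ U, x i - ∑ j ∈ V, x j := by
  have : NeZero K.n := ⟨by omega⟩
  set s : ℤ := ∑ i ∈ U, (x i).valMinAbs - ∑ j ∈ V, (x j).valMinAbs with hs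
  have hcast : (∑ i ∈ U, K.encode (x i) - ∑ j ∈ V, K.encode (x j) : K.Plain) = (s : K.Plain) := by
    simp only [encode, hs]
    push_cast
    rfl
  -- Each representative has absolute value at most `q / 2`, and the disjoint sets `U`, `V` have at
  -- most `N` members together. With `N q < n` the integer `s` is therefore its own least absolute
  -- representative modulo `n`, so decoding recovers it.
  have habs : |s| * 2 ≤ N * q := by
    have h1 : ∀ W : Finset (Fin N), |∑ i ∈ W, (x i).valMinAbs| * 2 ≤ W.card * q := by
      intro W
      calc |∑ i ∈ W, (x i).valMinAbs| * 2 ≤ (∑ i ∈ W, |(x i).valMinAbs|) * 2 := by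
            gcongr
            exact Finset.abs_sum_le_sum_abs _ _
        _ = ∑ i ∈ W, |(x i).valMinAbs| * 2 := Finset.sum_mul _ _ _
        _ ≤ ∑ i ∈ W, (q : ℤ) := by
            refine Finset.sum_le_sum fun i _ => ?_
            have h2 := (x i).valMinAbs_mem_Ioc
            rw [Set.mem_Ioc] at h2
            rcases abs_cases (x i).valMinAbs with h3 | h3 <;> omega
        _ = _ := by simp
    have h3 : U.card + V.card ≤ N := by
      rw [← Finset.card_union_of_disjoint hUV]
      simpa using Finset.card_le_univ (U ∪ V)
    have h4 := h1 U
    have h5 := h1 V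
    have h6 : |s| ≤ |∑ i ∈ U, (x i).valMinAbs| + |∑ j ∈ V, (x j).valMinAbs| := abs_sub _ _
    have h7 : ((U.card + V.card : ℕ) : ℤ) * q ≤ N * q := by gcongr
    push_cast at h7
    linarith
  have hval : (s : K.Plain).valMinAbs = s := by
    rw [ZMod.valMinAbs_spec]
    refine ⟨rfl, ?_⟩
    have hn' : (N * q : ℤ) < K.n := by exact_mod_cast hn
    rw [Set.mem_Ioc]
    rcases abs_cases s with h3 | h3 <;> constructor <;> omega
  rw [hcast, decode, hval, hs]
  push_cast
  simp

theorem Valid.decVec_aggregate (h : K.Valid) {q N d : ℕ} [NeZero q]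
    (hn : N * q < K.n) {U V : Finset (Fin N)} (hUV : Disjoint U V) {c : Fin N → Fin d → ZMod q}
    {x : Fin N → Fin d → K.Cipher} (hx : ∀ i k, K.IsEncryption (K.encode (c i k)) (x i k)) :
    K.decVec (K.aggregate U V x) = ∑ i ∈ U, c i - ∑ j ∈ V, c j := by
  funext k
  simp only [decVec, aggregate, Pi.sub_apply, Finset.sum_apply]
  rw [h.decrypt_aggregate U V fun i => hx i k, decode_sum hn hUV]

/-! ### Paillier operations on natural numbers -/

/-- The value `L (c ^ lam)` of a ciphertext, as a number. -/
theorem Valid.val_logL (h : K.Valid) (c : ℕ) :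
    (K.logL (c : K.Cipher)).val = ((c ^ K.lam % K.n ^ 2 - 1) / K.n) % K.n := by
  have := h.neZero
  rw [logL, L, ZMod.val_natCast, ← Nat.cast_pow, ZMod.val_natCast]

/-- By Euler's theorem an inverse modulo `n` is a power with exponent `φ(n) - 1`, so the holder of
the primes computes `mu` by modular exponentiation. -/
theorem Valid.mu_eq (h : K.Valid) :
    K.mu = K.logL K.g ^ ((K.p - 1) * (K.q - 1) - 1) := by
  have := h.neZero
  have ht : Nat.totient K.n = (K.p - 1) * (K.q - 1) := by
    rw [n, Nat.totient_mul ((Nat.coprime_primes h.1 h.2.1).2 h.2.2.1), Nat.totient_prime h.1,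
      Nat.totient_prime h.2.1]
  have hpos : 0 < Nat.totient K.n := Nat.totient_pos.2 (zero_lt_one.trans h.one_lt)
  have hu : IsUnit (K.logL K.g) := h.2.2.2.2.2
  have h1 : K.logL K.g ^ Nat.totient K.n = 1 := by
    obtain ⟨u, hu⟩ := hu
    rw [← hu, ← Units.val_pow_eq_pow_val, ZMod.pow_totient, Units.val_one]
  have h2 : K.mu * K.logL K.g = 1 := ZMod.inv_mul_of_unit _ hu
  rw [← ht]
  calc K.mu = K.mu * K.logL K.g ^ (Nat.totient K.n - 1 + 1) := by
        rw [Nat.sub_add_cancel hpos, h1, mul_one]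
    _ = K.mu * K.logL K.g * K.logL K.g ^ (Nat.totient K.n - 1) := by rw [pow_succ]; ring
    _ = _ := by rw [h2, one_mul]

/-- Encoding on representatives. -/
theorem val_encode {q : ℕ} [NeZero q] [NeZero K.n] (x : ZMod q) :
    (K.encode x).val = (if x.val ≤ q / 2 then x.val else x.val + q * K.n - q) % K.n := by
  -- The negative representative `x - q` is shifted by `q * n`, a multiple of the modulus, so that
  -- it becomes a natural number.
  have hle : q ≤ x.val + q * K.n := by
    have := Nat.le_mul_of_pos_right q (NeZero.pos K.n)
    omega
  have : K.encode x = ((if x.val ≤ q / 2 then x.val else x.val + q * K.n - q : ℕ) : K.Plain) := by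
    rw [encode, ZMod.valMinAbs_def_pos]
    split_ifs
    · simp
    · rw [Nat.cast_sub hle]
      push_cast
      simp
  rw [this, ZMod.val_natCast]

/-- Decoding on representatives. -/
theorem val_decode {q : ℕ} [NeZero q] [NeZero K.n] (y : K.Plain) :
    (K.decode y : ZMod q).val = (if y.val ≤ K.n / 2 then y.val else y.val + q * K.n - K.n) % q := by
  have hle : K.n ≤ y.val + q * K.n := by
    have := Nat.le_mul_of_pos_left K.n (NeZero.pos q)
    omega
  have : (K.decode y : ZMod q) =
      ((if y.val ≤ K.n / 2 then y.val else y.val + q * K.n - K.n : ℕ) : ZMod q) := by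
    rw [decode, ZMod.valMinAbs_def_pos]
    split_ifs
    · simp
    · rw [Nat.cast_sub hle]
      push_cast
      simp
  rw [this, ZMod.val_natCast]

end PaillierKey

/-! ### Algorithms -/

/-- One step of square-and-multiply on the accumulator, the base and the exponent. -/
def powStep (op : Data → Data → Data) (s : Data) : Data :=
  .pair (if s.snd.snd.toNat % 2 = 0 then s.fst else op s.fst s.snd.fst)
    (.pair (op s.snd.fst s.snd.fst) (.num (s.snd.snd.toNat / 2)))

/-- The product of `acc` and the power of `base` with exponent `u`, for the multiplication `op`. -/
def powAlg (op : Data → Data → Data) (acc base : Data) (u : ℕ) : Data :=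
  ((powStep op)^[Nat.size u] (.pair acc (.pair base (.num u)))).fst

/-- Each step preserves `acc * base ^ u` and halves `u`, which reaches `0` after `Nat.size u` steps.
Starting from an arbitrary accumulator avoids the need for a code of the neutral element. -/
theorem powAlg_eq {M : Type*} [CommMonoid M] {op : Data → Data → Data} {e : M → Data}
    (hop : ∀ a b, op (e a) (e b) = e (a * b)) (a b : M) (u : ℕ) :
    powAlg op (e a) (e b) u = e (a * b ^ u) := by
  have key : ∀ (k : ℕ) (a b : M) (u : ℕ), u < 2 ^ k →
      ((powStep op)^[k] (.pair (e a) (.pair (e b) (.num u)))).fst = e (a * b ^ u) := by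
    intro k
    induction k with
    | zero =>
      intro a b u hu
      have : u = 0 := by simpa using hu
      simp [this, Data.fst]
    | succ k ih =>
      intro a b u hu
      have hu' : u / 2 < 2 ^ k := by
        rw [pow_succ] at hu
        omega
      have hs : powStep op (.pair (e a) (.pair (e b) (.num u))) =
          .pair (e (if u % 2 = 0 then a else a * b)) (.pair (e (b * b)) (.num (u / 2))) := by
        simp only [powStep, Data.fst, Data.snd, Data.toNat, hop]
        split_ifs <;> rfl
      rw [Function.iterate_succ_apply, hs, ih _ _ _ hu']
      congr 1
      conv_rhs => rw [← Nat.div_add_mod u 2, pow_add, pow_mul, sq]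
      rcases Nat.mod_two_eq_zero_or_one u with h | h
      · simp [h]
      · simp [h, mul_comm]
        rw [mul_assoc]
  exact key _ _ _ _ (Nat.lt_size_self u)

/-- Polynomial time is required on all inputs, including those that are not codes of group elements.
A bound on the output of `op` that does not depend on its operands keeps repeated squaring from
increasing the lengths. -/
theorem PolyFun.powAlg {op : ℕ → Data → Data → Data → Data} {acc base : ℕ → Data → Data}
    {u B : ℕ → Data → ℕ} (hop : PolyFun fun κ z => op κ z.fst z.snd.fst z.snd.snd)
    (hB : PolyBdd B) (hsize : ∀ κ x a b, (op κ x a b).size ≤ B κ x) (hacc : PolyFun acc)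
    (hbase : PolyFun base) (hu : PolyNum u) :
    PolyFun fun κ x => VerFU.powAlg (op κ x) (acc κ x) (base κ x) (u κ x) := by
  obtain ⟨Sa, hSa, ha⟩ := hacc.size_le
  obtain ⟨Sb, hSb, hb⟩ := hbase.size_le
  obtain ⟨Su, hSu, hu'⟩ := hu.size_le
  refine PolyFun.fst (PolyFun.iterate (step := fun κ x => powStep (op κ x)) (B := Su)
    (S := fun κ x => (Sa κ x + B κ x) + (Sb κ x + B κ x) + Su κ x + 3)
    (init := fun κ x => .pair (acc κ x) (.pair (base κ x) (.num (u κ x)))) ?_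
    (hacc.pair (hbase.pair hu)) hu.natSize hSu hu'
    ((((hSa.add hB).add (hSb.add hB)).add hSu).add (.const 3)) ?_)
  · refine PolyFun.pair ?_ (PolyFun.pair ?_ ?_)
    · refine PolyFun.ite_num (((PolyNum.toNat PolyFun.id.snd.snd.snd)).mod (.const 2))
        PolyFun.id.snd.fst ?_
      exact hop.comp (PolyFun.id.fst.pair (PolyFun.id.snd.fst.pair PolyFun.id.snd.snd.fst))
    · exact hop.comp (PolyFun.id.fst.pair (PolyFun.id.snd.snd.fst.pair PolyFun.id.snd.snd.fst))
    · exact (PolyNum.toNat PolyFun.id.snd.snd.snd).div (.const 2)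
  · intro κ x k _
    have key : ∃ a b n, (powStep (op κ x))^[k] (.pair (acc κ x) (.pair (base κ x) (.num (u κ x)))) =
        .pair a (.pair b (.num n)) ∧ a.size ≤ Sa κ x + B κ x ∧ b.size ≤ Sb κ x + B κ x ∧
          n ≤ u κ x := by
      induction k with
      | zero => exact ⟨_, _, _, rfl, (ha κ x).trans (Nat.le_add_right _ _),
          (hb κ x).trans (Nat.le_add_right _ _), le_rfl⟩
      | succ k ih =>
        obtain ⟨a, b, n, h, h1, h2, h3⟩ := ih (by omega)
        rw [Function.iterate_succ_apply', h]
        refine ⟨_, _, _, rfl, ?_, (hsize κ x _ _).trans (Nat.le_add_left _ _),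
          (Nat.div_le_self _ _).trans h3⟩
        split_ifs
        · exact h1
        · exact (hsize κ x _ _).trans (Nat.le_add_left _ _)
    obtain ⟨a, b, n, h, h1, h2, h3⟩ := key
    have := (Nat.size_le_size h3).trans (hu' κ x)
    rw [h]
    simp only [Data.size]
    omega

/-- Powers modulo `M`. -/
def powMod (b e M : ℕ) : ℕ :=
  (powAlg (fun x y => .num (if M = 0 then 0 else x.toNat * y.toNat % M)) (.num (1 % M))
    (.num (b % M)) e).toNat

theorem powMod_eq {M : ℕ} (hM : M ≠ 0) (b e : ℕ) : powMod b e M = b ^ e % M := by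
  have : NeZero M := ⟨hM⟩
  have h := powAlg_eq (M := ZMod M) (op := fun x y => .num (if M = 0 then 0 else
    x.toNat * y.toNat % M)) (e := fun z => .num z.val) (fun a b => by
      simp [hM, Data.toNat, ZMod.val_mul]) ((1 : ℕ) : ZMod M) ((b : ℕ) : ZMod M) e
  simp only [ZMod.val_natCast] at h
  rw [powMod, h, Data.toNat, Nat.cast_one, one_mul, ← Nat.cast_pow, ZMod.val_natCast]

theorem PolyNum.powMod {b e M : ℕ → Data → ℕ} (hb : PolyNum b) (he : PolyNum e) (hM : PolyNum M) :
    PolyNum fun κ x => VerFU.powMod (b κ x) (e κ x) (M κ x) := by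
  obtain ⟨S, hS, h⟩ := hM.size_le
  refine PolyNum.toNat (PolyFun.powAlg (B := fun κ x => S κ x + 1)
    (op := fun κ x y z => .num (if M κ x = 0 then 0 else y.toNat * z.toNat % M κ x)) ?_
    (hS.add (.const 1)) ?_ ((PolyNum.const 1).mod hM) (hb.mod hM) he)
  · have hM' : PolyNum fun κ z => M κ z.fst := PolyFun.comp hM PolyFun.id.fst
    exact PolyNum.ite_num hM' (.const 0)
      (((PolyNum.toNat PolyFun.id.snd.fst).mul (PolyNum.toNat PolyFun.id.snd.snd)).mod hM')
  · intro κ x y z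
    refine Nat.succ_le_succ (le_trans (Nat.size_le_size ?_) (h κ x))
    -- The case `M = 0` is treated apart in `powMod` because reduction modulo `0` is the identity
    -- and would not bound the products.
    split_ifs with h0
    · exact Nat.zero_le _
    · exact (Nat.mod_lt _ (Nat.pos_of_ne_zero h0)).le

/-- One step of Euclid's algorithm. -/
def gcdStep (s : Data) : Data :=
  if s.snd.toNat = 0 then s else .pair s.snd (.num (s.fst.toNat % s.snd.toNat))

/-- Euclid's algorithm. -/
def gcdAlg (a b : ℕ) : ℕ :=
  (gcdStep^[Nat.size ((a + b) * b)] (.pair (.num (a + b)) (.num b))).fst.toNat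

/-- The start `(a + b, b)` has its larger entry first and the same gcd. From `b + a % b ≤ a` it
follows that the product of the two entries is at least halved in each step, so its bit length is a
sufficient number of iterations. -/
theorem gcdAlg_eq (a b : ℕ) : gcdAlg a b = Nat.gcd a b := by
  have key : ∀ (k a b : ℕ), b ≤ a → a * b < 2 ^ k →
      gcdStep^[k] (.pair (.num a) (.num b)) = .pair (.num (Nat.gcd a b)) (.num 0) := by
    intro k
    induction k with
    | zero =>
      intro a b h1 h2
      have : b = 0 := by
        by_contra hb
        have : 0 < a * b := Nat.mul_pos (by omega) (by omega)
        simp at h2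
        omega
      simp [this]
    | succ k ih =>
      intro a b h1 h2
      rw [Function.iterate_succ_apply]
      by_cases hb : b = 0
      · have : gcdStep (.pair (.num a) (.num b)) = .pair (.num a) (.num b) := by
          simp [gcdStep, Data.snd, Data.toNat, hb]
        rw [this]
        exact ih a b h1 (by simp [hb])
      · have : gcdStep (.pair (.num a) (.num b)) = .pair (.num b) (.num (a % b)) := by
          simp [gcdStep, Data.snd, Data.fst, Data.toNat, hb]
        have hlt : a % b < b := Nat.mod_lt _ (Nat.pos_of_ne_zero hb)
        have h3 : b + a % b ≤ a := by
          have h4 := Nat.div_add_mod a b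
          have h5 : b * 1 ≤ b * (a / b) :=
            Nat.mul_le_mul_left _ ((Nat.one_le_div_iff (Nat.pos_of_ne_zero hb)).2 h1)
          omega
        rw [this, ih b (a % b) hlt.le, Nat.gcd_comm a b, Nat.gcd_rec b a, Nat.gcd_comm]
        rw [pow_succ] at h2
        nlinarith
  rw [gcdAlg, key _ _ _ (Nat.le_add_left _ _) (Nat.lt_size_self _)]
  simp [Data.fst, Data.toNat]

theorem PolyNum.gcdAlg {a b : ℕ → Data → ℕ} (ha : PolyNum a) (hb : PolyNum b) :
    PolyNum fun κ x => VerFU.gcdAlg (a κ x) (b κ x) := by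
  have hc := ((ha.add hb).mul hb).natSize
  obtain ⟨S, hS, h⟩ := ((ha.add hb).mul hb).size_le
  obtain ⟨S', hS', h'⟩ := (ha.add hb).size_le
  refine PolyNum.toNat (PolyFun.fst (PolyFun.iterate (step := fun _ _ => gcdStep) (B := S)
    (S := fun κ x => S' κ x + S' κ x + 3)
    (init := fun κ x => .pair (.num (a κ x + b κ x)) (.num (b κ x))) ?_
    (PolyFun.pair (ha.add hb) hb) hc hS h ((hS'.add hS').add (.const 3)) ?_))
  · exact PolyFun.ite_num (PolyNum.toNat PolyFun.id.snd.snd) PolyFun.id.snd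
      (PolyFun.id.snd.snd.pair
        ((PolyNum.toNat PolyFun.id.snd.fst).mod (PolyNum.toNat PolyFun.id.snd.snd)))
  · intro κ x k _
    have key : ∃ m n, gcdStep^[k] (.pair (.num (a κ x + b κ x)) (.num (b κ x))) =
        .pair (.num m) (.num n) ∧ m ≤ a κ x + b κ x ∧ n ≤ a κ x + b κ x := by
      induction k with
      | zero => exact ⟨_, _, rfl, le_rfl, Nat.le_add_left _ _⟩
      | succ k ih =>
        obtain ⟨m, n, h, h1, h2⟩ := ih (by omega)
        rw [Function.iterate_succ_apply', h]
        by_cases hn : n = 0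
        · exact ⟨m, n, by simp [gcdStep, Data.snd, Data.toNat, hn], h1, h2⟩
        · exact ⟨n, m % n, by simp [gcdStep, Data.snd, Data.fst, Data.toNat, hn], h2,
            (Nat.mod_le _ _).trans h1⟩
    obtain ⟨m, n, h, h1, h2⟩ := key
    have e1 := (Nat.size_le_size h1).trans (h' κ x)
    have e2 := (Nat.size_le_size h2).trans (h' κ x)
    rw [h]
    simp only [Data.size]
    omega

theorem PolyNum.two_pow (p : Polynomial ℕ) : PolyNum fun κ _ => 2 ^ p.eval κ := by
  have hit : ∀ k, (fun s : Data => Data.num (s.toNat * 2))^[k] (.num 1) = .num (2 ^ k) := by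
    intro k
    induction k with
    | zero => rfl
    | succ k ih => rw [Function.iterate_succ_apply', ih, pow_succ]; rfl
  have h := PolyFun.iterate (step := fun _ _ s => .num (s.toNat * 2))
    (init := fun _ _ => .num 1) (count := fun κ _ => p.eval κ) (B := fun κ _ => p.eval κ)
    (S := fun κ _ => p.eval κ + 2) ((PolyNum.toNat PolyFun.id.snd).mul (.const 2)) (.num 1)
    (.polynomial_eval p) (PolyBdd.param.eval p) (fun _ _ => le_rfl)
    ((PolyBdd.param.eval p).add (.const 2)) fun κ x k hk => by
      rw [hit, Data.size, Nat.size_pow]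
      omega
  simp only [hit] at h
  exact h

/-! ### Group operations on codes -/

namespace GroupGen

variable (𝒢 : GroupGen)

/-- The multiplication algorithm, with its output truncated to the length of group elements. -/
def mulData (κ : ℕ) (P a b : Data) : Data :=
  .num ((𝒢.mulAlg (.list [P, a, b])).toNat % 2 ^ 𝒢.enc_len.choose.eval κ)

/-- The product of `acc` and a power of `base`, on codes of group elements. -/
def powData (κ : ℕ) (P acc base : Data) (u : ℕ) : Data := powAlg (𝒢.mulData κ P) acc base u

/-- The code of the neutral element. -/
def oneData (κ : ℕ) (P : Data) : Data :=
  𝒢.powData κ P (P.nth 2) (P.nth 2) ((P.nth 1).toNat - 1)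

/-- The hash function on codes. -/
def hashData (κ : ℕ) (P : Data) : {d : ℕ} → (Fin d → Data) → (Fin d → ℕ) → Data
  | 0, _, _ => 𝒢.oneData κ P
  | _ + 1, b, m => 𝒢.powData κ P (hashData κ P (fun k => b k.succ) fun k => m k.succ) (b 0) (m 0)

variable {𝒢} {κ : ℕ} {P : Data}

/-- On codes of group elements the truncation has no effect, by the length bound `enc_len`. On other
inputs it keeps the length polynomial, as `PolyFun.powAlg` demands. -/
theorem mulData_eq (hP : P ∈ (𝒢.setup κ).support) (a b : 𝒢.G P) :
    𝒢.mulData κ P (.num (𝒢.enc P a)) (.num (𝒢.enc P b)) = .num (𝒢.enc P (a * b)) := by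
  rw [mulData, 𝒢.mul_spec κ P hP, Data.toNat, Nat.mod_eq_of_lt]
  exact Nat.size_le.1 (𝒢.enc_len.choose_spec κ P hP _)

theorem powData_eq (hP : P ∈ (𝒢.setup κ).support) (a b : 𝒢.G P) (u : ℕ) :
    𝒢.powData κ P (.num (𝒢.enc P a)) (.num (𝒢.enc P b)) u = .num (𝒢.enc P (a * b ^ u)) :=
  powAlg_eq (e := fun a => .num (𝒢.enc P a)) (mulData_eq hP) a b u

theorem q_pos (P : Data) : 0 < 𝒢.q P := (𝒢.prime P).pos

theorem pow_q (a : 𝒢.G P) : a ^ 𝒢.q P = 1 := pow_card_eq_one'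

theorem toNat_order (hP : P ∈ (𝒢.setup κ).support) : (P.nth 1).toNat = 𝒢.q P := by
  rw [𝒢.order_spec κ P hP, Data.toNat]

/-- The group parameters contain a code of `g` but none of `1`, which is obtained as `g * g ^ (q -
1)`. -/
theorem oneData_eq (hP : P ∈ (𝒢.setup κ).support) : 𝒢.oneData κ P = .num (𝒢.enc P 1) := by
  rw [oneData, 𝒢.g_spec κ P hP, powData_eq hP, toNat_order hP, ← pow_succ',
    Nat.sub_add_cancel (q_pos P), pow_q]

theorem hashData_eq (hP : P ∈ (𝒢.setup κ).support) {d : ℕ} (b : Fin d → 𝒢.G P) (m : Fin d → ℕ) :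
    𝒢.hashData κ P (fun k => .num (𝒢.enc P (b k))) m = .num (𝒢.enc P (∏ k, b k ^ m k)) := by
  induction d with
  | zero => simp [hashData, oneData_eq hP]
  | succ d ih =>
    rw [hashData, ih (fun k => b k.succ), powData_eq hP, Fin.prod_univ_succ, mul_comm]

end GroupGen

section

variable {𝒢 : GroupGen} {P acc base : ℕ → Data → Data} {u : ℕ → Data → ℕ}

theorem PolyFun.mulData {a b : ℕ → Data → Data} (hP : PolyFun P) (ha : PolyFun a)
    (hb : PolyFun b) : PolyFun fun κ x => 𝒢.mulData κ (P κ x) (a κ x) (b κ x) := by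
  refine PolyNum.mod (PolyNum.toNat ?_) (PolyNum.two_pow _)
  exact PolyFun.comp (f := fun _ x => 𝒢.mulAlg x) 𝒢.mulAlg_poly
    (hP.listCons (ha.listCons (hb.listCons .listNil)))

theorem PolyFun.powData (hP : PolyFun P) (hacc : PolyFun acc) (hbase : PolyFun base)
    (hu : PolyNum u) : PolyFun fun κ x => 𝒢.powData κ (P κ x) (acc κ x) (base κ x) (u κ x) := by
  refine PolyFun.powAlg (op := fun κ x => 𝒢.mulData κ (P κ x))
    (B := fun κ _ => 𝒢.enc_len.choose.eval κ + 1)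
    (PolyFun.mulData (PolyFun.comp hP PolyFun.id.fst) PolyFun.id.snd.fst PolyFun.id.snd.snd)
    ((PolyBdd.param.eval _).add (.const 1)) ?_ hacc hbase hu
  intro κ x a b
  exact Nat.succ_le_succ (Nat.size_le.2 (Nat.mod_lt _ (Nat.two_pow_pos _)))

theorem PolyFun.oneData (hP : PolyFun P) : PolyFun fun κ x => 𝒢.oneData κ (P κ x) :=
  PolyFun.powData hP (hP.nth 2) (hP.nth 2) ((PolyNum.toNat (hP.nth 1)).sub (.const 1))

theorem PolyFun.hashData {d : ℕ} {b : Fin d → ℕ → Data → Data} {m : Fin d → ℕ → Data → ℕ}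
    (hP : PolyFun P) (hb : ∀ k, PolyFun (b k)) (hm : ∀ k, PolyNum (m k)) :
    PolyFun fun κ x => 𝒢.hashData κ (P κ x) (fun k => b k κ x) fun k => m k κ x := by
  induction d with
  | zero => exact PolyFun.oneData hP
  | succ d ih => exact PolyFun.powData hP (ih (fun k => hb k.succ) fun k => hm k.succ) (hb 0) (hm 0)

end

/-! ### Paillier operations on codes -/

/-- The exponent `lcm (p - 1) (q - 1)`. -/
def lamNum (p q : ℕ) : ℕ := (p - 1) * (q - 1) / gcdAlg (p - 1) (q - 1)

/-- The number `L (c ^ lam)`. -/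
def logNum (p q c : ℕ) : ℕ :=
  ((powMod c (lamNum p q) (p * q * (p * q)) - 1) / (p * q)) % (p * q)

/-- Decryption of a ciphertext. -/
def decNum (p q g c : ℕ) : ℕ :=
  logNum p q c * powMod (logNum p q g) ((p - 1) * (q - 1) - 1) (p * q) % (p * q)

/-- Encoding of a residue modulo `Q` as a plaintext modulo `n`. -/
def encodeNum (Q n x : ℕ) : ℕ := (if x ≤ Q / 2 then x else x + Q * n - Q) % n

/-- Decoding of a plaintext modulo `n` to a residue modulo `Q`. -/
def decodeNum (Q n y : ℕ) : ℕ := (if y ≤ n / 2 then y else y + Q * n - n) % Q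

/-- Encryption of `c` with a random number below `n`. -/
def encData (g n c : ℕ) : PMF Data :=
  ((unif n).map Data.num).bind fun r =>
    PMF.pure (.num (powMod g c (n * n) * powMod r.toNat n (n * n) % (n * n)))

section

variable {p q g n c : ℕ → Data → ℕ}

theorem PolyNum.lamNum (hp : PolyNum p) (hq : PolyNum q) :
    PolyNum fun κ x => VerFU.lamNum (p κ x) (q κ x) :=
  ((hp.sub (.const 1)).mul (hq.sub (.const 1))).div ((hp.sub (.const 1)).gcdAlg (hq.sub (.const 1)))

theorem PolyNum.logNum (hp : PolyNum p) (hq : PolyNum q) (hc : PolyNum c) :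
    PolyNum fun κ x => VerFU.logNum (p κ x) (q κ x) (c κ x) :=
  (((hc.powMod (hp.lamNum hq) ((hp.mul hq).mul (hp.mul hq))).sub (.const 1)).div (hp.mul hq)).mod
    (hp.mul hq)

theorem PolyNum.decNum (hp : PolyNum p) (hq : PolyNum q) (hg : PolyNum g) (hc : PolyNum c) :
    PolyNum fun κ x => VerFU.decNum (p κ x) (q κ x) (g κ x) (c κ x) :=
  ((hp.logNum hq hc).mul ((hp.logNum hq hg).powMod
    (((hp.sub (.const 1)).mul (hq.sub (.const 1))).sub (.const 1)) (hp.mul hq))).mod (hp.mul hq)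

theorem PolyNum.encodeNum (hq : PolyNum q) (hn : PolyNum n) (hc : PolyNum c) :
    PolyNum fun κ x => VerFU.encodeNum (q κ x) (n κ x) (c κ x) :=
  (PolyNum.ite_le hc (hq.div (.const 2)) hc ((hc.add (hq.mul hn)).sub hq)).mod hn

theorem PolyNum.decodeNum (hq : PolyNum q) (hn : PolyNum n) (hc : PolyNum c) :
    PolyNum fun κ x => VerFU.decodeNum (q κ x) (n κ x) (c κ x) :=
  (PolyNum.ite_le hc (hn.div (.const 2)) hc ((hc.add (hq.mul hn)).sub hn)).mod hq

theorem IsPPT.encData (hg : PolyNum g) (hn : PolyNum n) (hc : PolyNum c) :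
    IsPPT fun κ x => VerFU.encData (g κ x) (n κ x) (c κ x) := by
  refine (IsPPT.unif hn).bind ?_
  have hg' : PolyNum fun κ z => g κ z.fst := PolyFun.comp hg PolyFun.id.fst
  have hn' : PolyNum fun κ z => n κ z.fst := PolyFun.comp hn PolyFun.id.fst
  have hc' : PolyNum fun κ z => c κ z.fst := PolyFun.comp hc PolyFun.id.fst
  exact ((hg'.powMod hc' (hn'.mul hn')).mul
    ((PolyNum.toNat PolyFun.id.snd).powMod hn' (hn'.mul hn'))).mod (hn'.mul hn')

end

namespace PaillierKey

variable {K : PaillierKey}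

theorem lamNum_eq (K : PaillierKey) : lamNum K.p K.q = K.lam := by
  rw [lamNum, gcdAlg_eq]
  rfl

theorem Valid.logNum_eq (h : K.Valid) (c : ℕ) :
    logNum K.p K.q c = (K.logL (c : K.Cipher)).val := by
  have h0 : K.n ≠ 0 := h.neZero.ne
  rw [h.val_logL, logNum, lamNum_eq]
  change ((powMod c K.lam (K.n * K.n) - 1) / K.n) % K.n = _
  rw [powMod_eq (mul_ne_zero h0 h0), sq]

theorem Valid.decNum_eq (h : K.Valid) (c : ℕ) :
    decNum K.p K.q K.g c = (K.decrypt (c : K.Cipher)).val := by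
  have := h.neZero
  have h0 : K.n ≠ 0 := h.neZero.ne
  rw [decNum, h.logNum_eq, h.logNum_eq]
  change (K.logL (c : K.Cipher)).val * powMod _ _ K.n % K.n = _
  rw [powMod_eq h0]
  change _ = (K.logL (c : K.Cipher) * K.mu).val
  have hpow : ∀ (b : K.Plain) (e : ℕ), b.val ^ e % K.n = (b ^ e).val := fun b e => by
    rw [← ZMod.val_natCast, Nat.cast_pow, ZMod.natCast_zmod_val]
  rw [h.mu_eq, ZMod.val_mul, hpow]

theorem Valid.decodeNum_eq (h : K.Valid) {Q : ℕ} (hQ : 0 < Q) (c : ℕ) :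
    decodeNum Q K.n (decNum K.p K.q K.g c) =
      (K.decode (K.decrypt (c : K.Cipher)) : ZMod Q).val := by
  have := h.neZero
  have : NeZero Q := ⟨hQ.ne'⟩
  rw [val_decode, h.decNum_eq, decodeNum]

/-- The factor `3` pays for drawing the randomness among all residues. The relation remembers that
the ciphertext on the side of the protocol is a genuine encryption, which correctness of decryption
needs. -/
theorem Valid.dom_encrypt (h : K.Valid) {Q : ℕ} (hQ : 0 < Q) (c : ZMod Q) :
    Dom 3 (fun (x : K.Cipher) y => y = .num x.val ∧ K.IsEncryption (K.encode c) x)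
      (K.encrypt (K.encode c)) (encData K.g K.n (encodeNum Q K.n c.val)) := by
  have := h.neZero
  have hQ' : NeZero Q := ⟨hQ.ne'⟩
  have h0 : K.n ≠ 0 := h.neZero.ne
  have key := (dom_coprime h.1 h.2.1 h.2.2.1).bind (C' := 1)
    (R' := fun (x : K.Cipher) y => y = Data.num x.val ∧ K.IsEncryption (K.encode c) x)
    (k := fun r : ℕ => PMF.pure ((K.g : K.Cipher) ^ (K.encode c).val * (r : K.Cipher) ^ K.n))
    (l := fun r : ℕ => PMF.pure (Data.num (powMod K.g (encodeNum Q K.n c.val) (K.n * K.n) *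
      powMod r K.n (K.n * K.n) % (K.n * K.n)))) ?_
  · rw [mul_one] at key
    rw [encData, PMF.bind_map]
    exact key
  · rintro r _ ⟨rfl, hr⟩
    refine Dom.pure ⟨?_, r, hr, rfl⟩
    have e1 : encodeNum Q K.n c.val = (K.encode c).val := by rw [val_encode, encodeNum]
    rw [e1, powMod_eq (mul_ne_zero h0 h0), powMod_eq (mul_ne_zero h0 h0), ← Nat.mul_mod,
      ← sq, ← ZMod.val_natCast]
    push_cast
    rfl

end PaillierKey

/-! ### Simulation of the protocol on codes -/

namespace CommitmentScheme

variable {𝒞 : CommitmentScheme}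

theorem isPPT_rnd {pp : ℕ → Data → Data} (hpp : PolyFun pp) :
    IsPPT fun κ x => 𝒞.rnd (pp κ x) :=
  IsPPT.unif (PolyFun.comp (f := fun _ pp => .num (𝒞.rndCard pp)) 𝒞.rndCard_poly hpp)

theorem polyFun_com {pp m r : ℕ → Data → Data} (hpp : PolyFun pp) (hm : PolyFun m)
    (hr : PolyFun r) : PolyFun fun κ x => 𝒞.com (pp κ x) (m κ x) (r κ x) :=
  PolyFun.comp (f := fun _ z => 𝒞.com (z.nth 0) (z.nth 1) (z.nth 2)) 𝒞.com_poly
    (hpp.listCons (hm.listCons (hr.listCons .listNil)))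

end CommitmentScheme

namespace System

variable {N d : ℕ} (S : System N d)

/-- The order of the group, in the code of a setup. -/
def simQ (env : Data) : ℕ := ((env.nth 0).nth 1).toNat

/-- The Paillier modulus, in the code of a setup. -/
def simN (env : Data) : ℕ := (env.nth 3).toNat * (env.nth 4).toNat

/-- An entry of a gradient. -/
def simV (env : Data) (vs : Fin N → Data) (i : Fin N) (k : Fin d) : ℕ :=
  ((vs i).nth k).toNat % simQ env

/-- An entry of a historical contribution. -/
def simCv (t : ℕ) (env st : Data) (vs : Fin N → Data) (i : Fin N) (k : Fin d) : ℕ :=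
  if i ∈ S.users t then ((((st.nth 2).nth i).nth k).toNat + simV env vs i k) % simQ env
  else (((st.nth 2).nth i).nth k).toNat

/-- An entry of the vector that a device submits. -/
def simContrib (t : ℕ) (env st : Data) (vs : Fin N → Data) (i : Fin N) (k : Fin d) : ℕ :=
  if i ∈ S.unl t then S.simCv t env st vs i k else simV env vs i k

/-- An entry of the honest result. -/
def simResult (t : ℕ) (env st : Data) (vs : Fin N → Data) (k : Fin d) : ℕ :=
  (∑ i ∈ S.nor t, S.simContrib t env st vs i k +
    ∑ j ∈ S.unl t, (simQ env - S.simContrib t env st vs j k)) % simQ env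

/-- The hash value of a device. -/
def simHash (κ t : ℕ) (env st : Data) (vs : Fin N → Data) (i : Fin N) : Data :=
  S.lhh.hashData κ (env.nth 0) (fun k : Fin d => (env.nth 1).nth k)
    fun k : Fin d => S.simContrib t env st vs i k

/-- The commitment of a device. -/
def simCom (κ t : ℕ) (env st : Data) (vs r : Fin N → Data) (i : Fin N) : Data :=
  S.com.com (env.nth 2) (S.simHash κ t env st vs i) (r i)

/-- The ciphertext of a device. -/
def simEnc (t : ℕ) (env st : Data) (vs : Fin N → Data) (i : Fin N) : PMF Data :=
  (tuple fun k : Fin d => encData (env.nth 5).toNat (simN env)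
    (encodeNum (simQ env) (simN env) (S.simContrib t env st vs i k))).map Data.vec

/-- An entry of the decrypted result. -/
def simDec (env y : Data) (k : ℕ) : ℕ :=
  decodeNum (simQ env) (simN env)
    (decNum (env.nth 3).toNat (env.nth 4).toNat (env.nth 5).toNat (y.snd.nth k).toNat)

/-- The new state and the transcript of a round: the list of the state of the adversary, the
history, the historical contributions, the commitments, the hash values, the randomness of the
commitments, the relayed openings and the honest result. -/
def simState (κ t : ℕ) (env st : Data) (vs r : Fin N → Data) (y z : Data) : Data :=
  .list [z.fst, .pair (.vec fun k : Fin d => .num (simDec env y k)) (st.nth 1),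
    .vec fun i => .vec fun k => .num (S.simCv t env st vs i k),
    .vec fun i => S.simCom κ t env st vs r i, .vec fun i => S.simHash κ t env st vs i, .vec r,
    z.snd, .vec fun k => .num (S.simResult t env st vs k)]

/-- A round of the protocol on codes. -/
def simRound (A : ℕ → Data → PMF Data) (κ t : ℕ) (env st : Data) : PMF Data :=
  (tuple fun i : Fin N => S.train κ (.list [.num t, .num i, (env.nth 6).nth i, .num (simQ env),
    env.nth 7, st.nth 1])).bind fun vs =>
  (tuple fun _ : Fin N => S.com.rnd (env.nth 2)).bind fun r =>
  (tuple fun i : Fin N => S.simEnc t env st vs i).bind fun x =>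
  (A κ (.pair (st.nth 0) (.vec fun i : Fin N => if i ∈ S.users t then
    .list [S.simCom κ t env st vs r i, x i, .num (if i ∈ S.unl t then 0 else 1)]
    else .num 0))).bind fun y =>
  (A κ (.pair y.fst (.vec fun i : Fin N => if i ∈ S.users t then
    .pair (S.simHash κ t env st vs i) (r i) else .num 0))).bind fun z =>
  PMF.pure (S.simState κ t env st vs r y z)

/-- The first `t` rounds on codes. -/
def simRounds (A : ℕ → Data → PMF Data) (κ : ℕ) (env adv : Data) : ℕ → PMF Data
  | 0 => PMF.pure (.list [adv, .list [],
      .vec fun _ : Fin N => .vec fun _ : Fin d => .num 0])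
  | t + 1 => (simRounds A κ env adv t).bind fun st => S.simRound A κ (t + 1) env st

/-- Everything that follows the choice of the group, of the bases of the hash and of the parameters
of the commitment scheme, which are given by a list. -/
def simBody (A : ℕ → Data → PMF Data) (t κ : ℕ) (inp : Data) : PMF Data :=
  ((S.heGen κ).map fun K => Data.list [.num K.p, .num K.q, .num K.g]).bind fun k =>
  (S.dataGen κ).bind fun D =>
  (A κ (.pair (.num 0) (.list [inp.nth 0, inp.nth 1, inp.nth 2,
    .num ((k.nth 0).toNat * (k.nth 1).toNat), k.nth 2]))).bind fun y =>
  S.simRounds A κ (.list [inp.nth 0, inp.nth 1, inp.nth 2, k.nth 0, k.nth 1, k.nth 2, D, y.snd])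
    y.fst t

/-! ### Polynomial-time computability of the simulation. -/

section

variable {S} {env st : ℕ → Data → Data} {vs r : Fin N → ℕ → Data → Data}

theorem polyNum_simQ (henv : PolyFun env) : PolyNum fun κ x => simQ (env κ x) :=
  PolyNum.toNat ((henv.nth 0).nth 1)

theorem polyNum_simN (henv : PolyFun env) : PolyNum fun κ x => simN (env κ x) :=
  (PolyNum.toNat (henv.nth 3)).mul (PolyNum.toNat (henv.nth 4))

theorem polyNum_simV (henv : PolyFun env) (hvs : ∀ i, PolyFun (vs i)) (i : Fin N) (k : Fin d) :
    PolyNum fun κ x => simV (env κ x) (fun i => vs i κ x) i k :=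
  (PolyNum.toNat ((hvs i).nth k)).mod (polyNum_simQ henv)

theorem polyNum_simCv (t : ℕ) (henv : PolyFun env) (hst : PolyFun st) (hvs : ∀ i, PolyFun (vs i))
    (i : Fin N) (k : Fin d) :
    PolyNum fun κ x => S.simCv t (env κ x) (st κ x) (fun i => vs i κ x) i k := by
  have h := PolyNum.toNat (((hst.nth 2).nth i).nth k)
  exact PolyNum.ite_prop _ ((h.add (polyNum_simV henv hvs i k)).mod (polyNum_simQ henv)) h

theorem polyNum_simContrib (t : ℕ) (henv : PolyFun env) (hst : PolyFun st)
    (hvs : ∀ i, PolyFun (vs i)) (i : Fin N) (k : Fin d) :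
    PolyNum fun κ x => S.simContrib t (env κ x) (st κ x) (fun i => vs i κ x) i k :=
  PolyNum.ite_prop _ (polyNum_simCv t henv hst hvs i k) (polyNum_simV henv hvs i k)

theorem polyNum_simResult (t : ℕ) (henv : PolyFun env) (hst : PolyFun st)
    (hvs : ∀ i, PolyFun (vs i)) (k : Fin d) :
    PolyNum fun κ x => S.simResult t (env κ x) (st κ x) (fun i => vs i κ x) k :=
  ((PolyNum.sum _ fun i => polyNum_simContrib t henv hst hvs i k).add (PolyNum.sum _ fun i =>
    (polyNum_simQ henv).sub (polyNum_simContrib t henv hst hvs i k))).mod (polyNum_simQ henv)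

theorem polyFun_simHash (t : ℕ) (henv : PolyFun env) (hst : PolyFun st)
    (hvs : ∀ i, PolyFun (vs i)) (i : Fin N) :
    PolyFun fun κ x => S.simHash κ t (env κ x) (st κ x) (fun i => vs i κ x) i :=
  PolyFun.hashData (henv.nth 0) (fun k => (henv.nth 1).nth k)
    fun k => polyNum_simContrib t henv hst hvs i k

theorem polyFun_simCom (t : ℕ) (henv : PolyFun env) (hst : PolyFun st)
    (hvs : ∀ i, PolyFun (vs i)) (hr : ∀ i, PolyFun (r i)) (i : Fin N) :
    PolyFun fun κ x =>
      S.simCom κ t (env κ x) (st κ x) (fun i => vs i κ x) (fun i => r i κ x) i :=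
  S.com.polyFun_com (henv.nth 2) (polyFun_simHash t henv hst hvs i) (hr i)

theorem isPPT_simEnc (t : ℕ) (henv : PolyFun env) (hst : PolyFun st)
    (hvs : ∀ i, PolyFun (vs i)) (i : Fin N) :
    IsPPT fun κ x => S.simEnc t (env κ x) (st κ x) (fun i => vs i κ x) i :=
  IsPPT.map_tuple (f := fun _ _ => Data.vec) (fun k => IsPPT.encData (PolyNum.toNat (henv.nth 5))
    (polyNum_simN henv) (PolyNum.encodeNum (polyNum_simQ henv) (polyNum_simN henv)
      (polyNum_simContrib t henv hst hvs i k))) (PolyFun.vec fun k => PolyFun.id.snd.nth k)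

theorem polyNum_simDec {y : ℕ → Data → Data} (henv : PolyFun env) (hy : PolyFun y) (k : ℕ) :
    PolyNum fun κ x => simDec (env κ x) (y κ x) k :=
  PolyNum.decodeNum (polyNum_simQ henv) (polyNum_simN henv)
    (PolyNum.decNum (PolyNum.toNat (henv.nth 3)) (PolyNum.toNat (henv.nth 4))
      (PolyNum.toNat (henv.nth 5)) (PolyNum.toNat (hy.snd.nth k)))

theorem polyFun_simState {y z : ℕ → Data → Data} (t : ℕ) (henv : PolyFun env) (hst : PolyFun st)
    (hvs : ∀ i, PolyFun (vs i)) (hr : ∀ i, PolyFun (r i)) (hy : PolyFun y) (hz : PolyFun z) :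
    PolyFun fun κ x => S.simState κ t (env κ x) (st κ x) (fun i => vs i κ x) (fun i => r i κ x)
      (y κ x) (z κ x) := by
  refine hz.fst.listCons (PolyFun.listCons (PolyFun.pair (PolyFun.vec fun k =>
      polyNum_simDec henv hy k) (hst.nth 1))
    (PolyFun.listCons (PolyFun.vec fun i => PolyFun.vec fun k => polyNum_simCv t henv hst hvs i k)
    (PolyFun.listCons (PolyFun.vec fun i => polyFun_simCom t henv hst hvs hr i)
    (PolyFun.listCons (PolyFun.vec fun i => polyFun_simHash t henv hst hvs i)
    (PolyFun.listCons (PolyFun.vec hr)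
    (hz.snd.listCons (PolyFun.listCons (PolyFun.vec fun k => polyNum_simResult t henv hst hvs k)
      PolyFun.listNil)))))))

end

variable {S}

theorem isPPT_simRound {A : ℕ → Data → PMF Data} (hA : IsPPT A) (t : ℕ) :
    IsPPT fun κ x => S.simRound A κ t x.fst x.snd := by
  have id := PolyFun.id
  -- Each sample pairs the context with a new value. A chain of `fst` reaches past the later
  -- samples, and a final `snd` selects the one that is wanted.
  refine IsPPT.bind_tuple (fun i => ?_) ?_
  · exact S.train_ppt.comp (PolyFun.listCons (.num t) (PolyFun.listCons (.num i)
      (PolyFun.listCons ((id.fst.nth 6).nth i) (PolyFun.listCons (polyNum_simQ id.fst)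
        (PolyFun.listCons (id.fst.nth 7) (PolyFun.listCons (id.snd.nth 1) .listNil))))))
  refine IsPPT.bind_tuple (fun i => S.com.isPPT_rnd (id.fst.fst.nth 2)) ?_
  refine IsPPT.bind_tuple (fun i => isPPT_simEnc t id.fst.fst.fst id.fst.fst.snd
    (fun i => id.fst.snd.nth i) i) ?_
  refine IsPPT.bind (hA.comp ?_) ?_
  · refine PolyFun.pair (id.fst.fst.fst.snd.nth 0) (PolyFun.vec fun i => PolyFun.ite_prop _ ?_
      (.num 0))
    exact PolyFun.listCons (polyFun_simCom t id.fst.fst.fst.fst id.fst.fst.fst.snd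
      (fun i => id.fst.fst.snd.nth i) (fun i => id.fst.snd.nth i) i)
      (PolyFun.listCons (id.snd.nth i) (PolyFun.listCons (.num _) .listNil))
  refine IsPPT.bind (hA.comp ?_) ?_
  · exact PolyFun.pair id.snd.fst (PolyFun.vec fun i => PolyFun.ite_prop _
      (PolyFun.pair (polyFun_simHash t id.fst.fst.fst.fst.fst id.fst.fst.fst.fst.snd
        (fun i => id.fst.fst.fst.snd.nth i) i) (id.fst.fst.snd.nth i)) (.num 0))
  exact polyFun_simState t id.fst.fst.fst.fst.fst.fst id.fst.fst.fst.fst.fst.snd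
    (fun i => id.fst.fst.fst.fst.snd.nth i) (fun i => id.fst.fst.fst.snd.nth i) id.fst.snd id.snd

theorem isPPT_simRounds {A : ℕ → Data → PMF Data} (hA : IsPPT A) (t : ℕ) :
    IsPPT fun κ x => S.simRounds A κ x.fst x.snd t := by
  induction t with
  | zero =>
    exact PolyFun.listCons PolyFun.id.snd (PolyFun.listCons .listNil (PolyFun.listCons
      (PolyFun.const (.vec fun _ : Fin N => .vec fun _ : Fin d => .num 0)) .listNil))
  | succ t ih =>
    exact ih.bind ((isPPT_simRound hA (t + 1)).comp (PolyFun.id.fst.fst.pair PolyFun.id.snd))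

theorem isPPT_simBody {A : ℕ → Data → PMF Data} (hA : IsPPT A) (t : ℕ) :
    IsPPT (S.simBody A t) := by
  have id := PolyFun.id
  refine IsPPT.bind S.heGen_ppt (IsPPT.bind (S.dataGen_ppt) (IsPPT.bind (hA.comp ?_) ?_))
  · exact PolyFun.pair (.num 0) (PolyFun.listCons (id.fst.fst.nth 0) (PolyFun.listCons
      (id.fst.fst.nth 1) (PolyFun.listCons (id.fst.fst.nth 2) (PolyFun.listCons
        ((PolyNum.toNat (id.fst.snd.nth 0)).mul (PolyNum.toNat (id.fst.snd.nth 1)))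
        (PolyFun.listCons (id.fst.snd.nth 2) .listNil)))))
  · refine (isPPT_simRounds (S := S) hA t).comp (f := fun _ x => .pair (.list [x.fst.fst.fst.nth 0,
      x.fst.fst.fst.nth 1, x.fst.fst.fst.nth 2, x.fst.fst.snd.nth 0, x.fst.fst.snd.nth 1,
      x.fst.fst.snd.nth 2, x.fst.snd, x.snd.snd]) x.snd.fst) (PolyFun.pair ?_ id.snd.fst)
    exact PolyFun.listCons (id.fst.fst.fst.nth 0) (PolyFun.listCons (id.fst.fst.fst.nth 1)
      (PolyFun.listCons (id.fst.fst.fst.nth 2) (PolyFun.listCons (id.fst.fst.snd.nth 0)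
        (PolyFun.listCons (id.fst.fst.snd.nth 1) (PolyFun.listCons (id.fst.fst.snd.nth 2)
          (PolyFun.listCons id.fst.snd (PolyFun.listCons id.snd.snd .listNil)))))))

end System

theorem Data.nth_vec {n : ℕ} (v : Fin n → Data) (i : Fin n) : (Data.vec v).nth i = v i := by
  induction n with
  | zero => exact i.elim0
  | succ n ih =>
    simp only [Data.vec, List.ofFn_succ, Data.list] at ih ⊢
    refine Fin.cases ?_ (fun i => ?_) i
    · rfl
    · exact ih (fun i => v i.succ) i

/-! ### Linearity of the hash -/

namespace GroupGen

variable {𝒢 : GroupGen} {P : Data} {d : ℕ} (b : Fin d → 𝒢.G P)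

instance neZero_q (P : Data) : NeZero (𝒢.q P) := ⟨(𝒢.prime P).ne_zero⟩

theorem pow_mod_q (a : 𝒢.G P) (n : ℕ) : a ^ (n % 𝒢.q P) = a ^ n := pow_mod_natCard a n

/-- Reducing an exponent modulo the group order does not change the power, so passing to
representatives in `ZMod q` is harmless. -/
theorem hash_add (m m' : Fin d → ZMod (𝒢.q P)) :
    𝒢.hash b (m + m') = 𝒢.hash b m * 𝒢.hash b m' := by
  simp only [hash, Pi.add_apply, ZMod.val_add, pow_mod_q, pow_add, Finset.prod_mul_distrib]

theorem hash_zero : 𝒢.hash b 0 = 1 := by simp [hash]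

theorem hash_neg (m : Fin d → ZMod (𝒢.q P)) : 𝒢.hash b (-m) = (𝒢.hash b m)⁻¹ :=
  eq_inv_of_mul_eq_one_left (by rw [← hash_add, neg_add_cancel, hash_zero])

theorem hash_sum {ι : Type*} (s : Finset ι) (m : ι → Fin d → ZMod (𝒢.q P)) :
    𝒢.hash b (∑ i ∈ s, m i) = ∏ i ∈ s, 𝒢.hash b (m i) := by
  classical
  induction s using Finset.induction_on with
  | empty => simp [hash_zero]
  | insert i s hi ih => rw [Finset.sum_insert hi, Finset.prod_insert hi, hash_add, ih]

end GroupGen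

namespace System

variable {N d : ℕ} {S : System N d}

theorem disjoint_nor_unl (t : ℕ) : Disjoint (S.nor t) (S.unl t) := Finset.sdiff_disjoint

theorem hashEval_hash {P : Data} (b : Fin d → S.lhh.G P) (t : ℕ)
    (c : Fin N → Fin d → ZMod (S.lhh.q P)) :
    S.lhh.hashEval (S.users t) (fun i => S.lhh.hash b (c i)) (S.status t) =
      S.lhh.hash b (∑ i ∈ S.nor t, c i - ∑ j ∈ S.unl t, c j) := by
  rw [sub_eq_add_neg, GroupGen.hash_add, GroupGen.hash_neg, GroupGen.hash_sum, GroupGen.hash_sum,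
    GroupGen.hashEval, ← Finset.prod_sdiff (S.unl_sub t), ← Finset.prod_inv_distrib]
  congr 1
  · refine Finset.prod_congr rfl fun i hi => ?_
    rw [status, if_neg (Finset.mem_sdiff.1 hi).2, zpow_one]
  · refine Finset.prod_congr rfl fun i hi => ?_
    rw [status, if_pos hi, zpow_neg_one]

/-! ### The simulation dominates the protocol -/

/-- The code of a setup. -/
def code (E : S.Setup) : Data :=
  .list [E.P, .vec fun k => .num (S.lhh.enc E.P (E.b k)), E.pp, .num E.K.p, .num E.K.q, .num E.K.g,
    E.D, E.w]

/-- The transcript has two openings of the commitment of the device `j` to different hash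
values. -/
def DoubleOpening (S : System N d) (P pp st : Data) (j : Fin N) : Prop :=
  ∃ h h' : S.lhh.G P, h ≠ h' ∧
    (st.nth 4).nth j = .num (S.lhh.enc P h) ∧
    ((st.nth 6).nth j).fst = .num (S.lhh.enc P h') ∧
    S.com.dec pp ((st.nth 3).nth j) (.num (S.lhh.enc P h)) ((st.nth 5).nth j) ∧
    S.com.dec pp ((st.nth 3).nth j) (.num (S.lhh.enc P h')) ((st.nth 6).nth j).snd

/-- The result in the transcript and the honest result differ at `k`, and have the same hash. -/
def Collision (S : System N d) {P : Data} (b : Fin d → S.lhh.G P) (st : Data) (k : Fin d) : Prop :=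
  ∃ a a' : Fin d → ZMod (S.lhh.q P), (∀ l : Fin d, (st.nth 7).nth l = .num (a l).val) ∧
    (∀ l : Fin d, (st.nth 1).fst.nth l = .num (a' l).val) ∧ a' k ≠ a k ∧
    S.lhh.hash b a' = S.lhh.hash b a

/-- The code `st` represents the state `σ`, and has a double opening or a collision if a device
was fooled. -/
structure Represents (E : S.Setup) (σ : State N d (S.lhh.q E.P)) (st : Data) : Prop where
  adv : st.nth 0 = σ.adv
  hist : st.nth 1 = .list (σ.hist.map fun a => .vec fun k => .num (a k).val)
  cv : ∀ i k, (((st.nth 2).nth (i : Fin N)).nth (k : Fin d)).toNat = (σ.cv i k).val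
  fooled : (∃ i, σ.fooled i) →
    (∃ j, S.DoubleOpening E.P E.pp st j) ∨ ∃ k, S.Collision E.b st k

section

variable {A : ℕ → Data → PMF Data} {κ : ℕ} {E : S.Setup}

theorem simQ_code (hP : E.P ∈ (S.lhh.setup κ).support) : simQ (code E) = S.lhh.q E.P :=
  GroupGen.toNat_order hP

theorem simN_code : simN (code E) = E.K.n := rfl

variable {t : ℕ} {σ : State N d (S.lhh.q E.P)} {st : Data} {vs : Fin N → Data}

theorem simV_eq (hP : E.P ∈ (S.lhh.setup κ).support) (i : Fin N) (k : Fin d) :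
    simV (code E) vs i k = (((vs i).nth k).toNat : ZMod (S.lhh.q E.P)).val := by
  rw [simV, simQ_code hP, ZMod.val_natCast]

theorem simCv_eq (hP : E.P ∈ (S.lhh.setup κ).support) (hst : Represents E σ st) (i : Fin N)
    (k : Fin d) :
    S.simCv t (code E) st vs i k = ((if i ∈ S.users t then σ.cv i + fun k : Fin d =>
      (((vs i).nth k).toNat : ZMod (S.lhh.q E.P)) else σ.cv i) k).val := by
  rw [simCv, hst.cv, simV_eq hP, simQ_code hP]
  split_ifs
  · rw [Pi.add_apply, ZMod.val_add]
  · rfl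

theorem simContrib_eq (hP : E.P ∈ (S.lhh.setup κ).support) (hst : Represents E σ st)
    {c : Fin N → Fin d → ZMod (S.lhh.q E.P)}
    (hc : c = fun i => if i ∈ S.unl t then (if i ∈ S.users t then σ.cv i + fun k : Fin d =>
      (((vs i).nth k).toNat : ZMod (S.lhh.q E.P)) else σ.cv i) else fun k : Fin d =>
      (((vs i).nth k).toNat : ZMod (S.lhh.q E.P))) (i : Fin N) (k : Fin d) :
    S.simContrib t (code E) st vs i k = (c i k).val := by
  rw [simContrib, simCv_eq hP hst, simV_eq hP]
  subst hc
  beta_reduce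
  split_ifs <;> rfl

variable {c : Fin N → Fin d → ZMod (S.lhh.q E.P)}

theorem simHash_eq (hP : E.P ∈ (S.lhh.setup κ).support)
    (hc : ∀ i k, S.simContrib t (code E) st vs i k = (c i k).val) (i : Fin N) :
    S.simHash κ t (code E) st vs i = .num (S.lhh.enc E.P (S.lhh.hash E.b (c i))) := by
  have hb : ∀ k : Fin d, ((code E).nth 1).nth k = .num (S.lhh.enc E.P (E.b k)) :=
    Data.nth_vec _
  simp only [simHash, hb, hc]
  exact GroupGen.hashData_eq hP _ _

/-- The simulation obtains the honest result from the contributions, without decrypting: its own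
ciphertexts may be malformed. As `c < q`, the natural number `q - c` represents `-c`. -/
theorem simResult_eq (hP : E.P ∈ (S.lhh.setup κ).support)
    (hc : ∀ i k, S.simContrib t (code E) st vs i k = (c i k).val) (k : Fin d) :
    S.simResult t (code E) st vs k = ((∑ i ∈ S.nor t, c i - ∑ j ∈ S.unl t, c j) k).val := by
  simp only [simResult, simQ_code hP, hc]
  rw [← ZMod.val_natCast]
  congr 1
  simp only [Pi.sub_apply, Finset.sum_apply, Nat.cast_add, Nat.cast_sum]
  rw [sub_eq_add_neg, ← Finset.sum_neg_distrib]
  congr 1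
  · simp
  · refine Finset.sum_congr rfl fun i _ => ?_
    rw [Nat.cast_sub (ZMod.val_lt _).le, ZMod.natCast_self, zero_sub, ZMod.natCast_zmod_val]

theorem dom_simEnc (hP : E.P ∈ (S.lhh.setup κ).support)
    (hc : ∀ i k, S.simContrib t (code E) st vs i k = (c i k).val)
    (hK : E.K.Valid) (i : Fin N) :
    Dom (3 ^ d) (fun x y => y = Data.vec (fun k => .num (x k).val) ∧
      ∀ k, E.K.IsEncryption (E.K.encode (c i k)) (x k))
      (E.K.encVec (c i)) (S.simEnc t (code E) st vs i) := by
  rw [← mul_one (3 ^ d)]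
  have h := Dom.tuple fun k => hK.dom_encrypt (S.lhh.q_pos E.P) (c i k)
  have h2 := h.bind (C' := 1) (R' := fun (x : Fin d → E.K.Cipher) y =>
    y = Data.vec (fun k => .num (x k).val) ∧ ∀ k, E.K.IsEncryption (E.K.encode (c i k)) (x k))
    (k := PMF.pure) (l := fun y => PMF.pure (Data.vec y)) fun x y hxy =>
      Dom.pure ⟨by congr 1; exact funext fun k => (hxy k).1, fun k => (hxy k).2⟩
  rw [PMF.bind_pure] at h2
  simp only [simEnc, simN_code, simQ_code hP, hc]
  exact h2

theorem simDec_eq (hP : E.P ∈ (S.lhh.setup κ).support) (hK : E.K.Valid) (y : Data) (k : ℕ) :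
    simDec (code E) y k = (E.K.decode (E.K.decrypt ((y.snd.nth k).toNat : E.K.Cipher)) :
      ZMod (S.lhh.q E.P)).val := by
  rw [simDec, simN_code, simQ_code hP]
  exact hK.decodeNum_eq (S.lhh.q_pos E.P) _

/-- A fooled device gives a double opening or a collision. -/
theorem exists_doubleOpening_or_collision {i : Fin N} {m : Fin N → Data}
    {h : Fin N → S.lhh.G E.P} {r : Fin N → Data} {z : Data} {st' : Data}
    {c : Fin N → Fin d → ZMod (S.lhh.q E.P)} {a a' : Fin d → ZMod (S.lhh.q E.P)}
    (hh : h = fun i => S.lhh.hash E.b (c i))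
    (hm : m = fun i => S.com.com E.pp (.num (S.lhh.enc E.P (h i))) (r i))
    (ha : a = ∑ i ∈ S.nor t, c i - ∑ j ∈ S.unl t, c j) (hne : a' ≠ a)
    (hacc : accepts E t i m h (fun j => z.nth j) a')
    (h1 : ∀ k : Fin d, (st'.nth 1).fst.nth k = .num (a' k).val)
    (h3 : ∀ j : Fin N, (st'.nth 3).nth j = m j)
    (h4 : ∀ j : Fin N, (st'.nth 4).nth j = .num (S.lhh.enc E.P (h j)))
    (h5 : ∀ j : Fin N, (st'.nth 5).nth j = r j) (h6 : st'.nth 6 = z)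
    (h7 : ∀ k : Fin d, (st'.nth 7).nth k = .num (a k).val) :
    (∃ j, S.DoubleOpening E.P E.pp st' j) ∨ ∃ k, S.Collision E.b st' k := by
  obtain ⟨h', hi, hopn, hhash⟩ := hacc
  -- If all relayed hash values are honest, linearity makes the accepted equation a collision; a
  -- single dishonest one is a second opening of its commitment.
  by_cases hall : ∀ j ∈ S.users t, h' j = h j
  · right
    obtain ⟨k, hk⟩ := Function.ne_iff.1 hne
    refine ⟨k, a, a', h7, h1, hk, ?_⟩
    rw [hhash, ha, ← hashEval_hash, ← hh]
    exact Finset.prod_congr rfl fun j hj => by rw [hall j hj]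
  · left
    push Not at hall
    obtain ⟨j, hj, hne'⟩ := hall
    -- The verifying device uses its own hash value, so the dishonest one belongs to another device,
    -- whose opening has been checked.
    have hji : j ≠ i := fun e => hne' (e ▸ hi)
    obtain ⟨e1, e2⟩ := hopn j hj hji
    refine ⟨j, h j, h' j, hne'.symm, h4 j, ?_, ?_, ?_⟩
    · rw [h6]
      exact e1
    · rw [h3, h5, hm]
      rfl
    · rw [h3, h6]
      exact e2

theorem dom_round (hP : E.P ∈ (S.lhh.setup κ).support) (hK : E.K.Valid)
    (hn : N * S.lhh.q E.P < E.K.n) (hst : Represents E σ st) :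
    Dom ((3 ^ d) ^ N) (Represents E) (round A κ E t σ) (S.simRound A κ t (code E) st) := by
  simp only [round, simRound, Bind.bind]
  refine Dom.bind_one (R := Eq) (Dom.of_eq ?_) ?_
  · rw [simQ_code hP, hst.hist]
    rfl
  rintro vs _ rfl
  refine Dom.bind_one (Dom.refl _) ?_
  rintro r _ rfl
  generalize hc : (fun i : Fin N => if i ∈ S.unl t then (if i ∈ S.users t then σ.cv i +
    fun k : Fin d => (((vs i).nth k).toNat : ZMod (S.lhh.q E.P)) else σ.cv i) else fun k : Fin d =>
      (((vs i).nth k).toNat : ZMod (S.lhh.q E.P))) = c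
  have hc' : ∀ i, (if i ∈ S.unl t then (if i ∈ S.users t then σ.cv i +
    fun k : Fin d => (((vs i).nth k).toNat : ZMod (S.lhh.q E.P)) else σ.cv i) else fun k : Fin d =>
      (((vs i).nth k).toNat : ZMod (S.lhh.q E.P))) = c i := fun i => congrFun hc i
  simp only [hc']
  have hcontrib := simContrib_eq hP hst hc.symm
  have hhash := simHash_eq hP hcontrib
  have hcom : ∀ i, S.simCom κ t (code E) st vs r i =
      S.com.com E.pp (.num (S.lhh.enc E.P (S.lhh.hash E.b (c i)))) (r i) := fun i => by
    rw [simCom, hhash]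
    rfl
  rw [← mul_one ((3 ^ d) ^ N)]
  -- Only encryption costs a factor, `3 ^ d` for each of the `N` devices; all other samples have the
  -- same law on both sides.
  refine (Dom.tuple fun i => dom_simEnc hP hcontrib hK i).bind ?_
  rintro x x' hx
  refine Dom.bind_one (R := Eq) (Dom.of_eq ?_) ?_
  · simp only [hst.adv, hcom, fun i => (hx i).1]
  rintro y _ rfl
  refine Dom.bind_one (R := Eq) (Dom.of_eq ?_) ?_
  · simp only [hhash]
  rintro z _ rfl
  refine Dom.pure ?_
  have ha := hK.decVec_aggregate hn (disjoint_nor_unl (S := S) t) (c := c) (x := x)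
    fun i k => (hx i).2 k
  refine ⟨rfl, ?_, ?_, ?_⟩
  · change Data.pair (.vec fun k : Fin d => .num (simDec (code E) y k)) (st.nth 1) = _
    rw [hst.hist]
    simp only [simDec_eq hP hK]
    rfl
  · intro i k
    change ((Data.nth i (.vec fun i => .vec fun k => .num (S.simCv t (code E) st vs i k))).nth
      k).toNat = _
    rw [Data.nth_vec, Data.nth_vec, Data.toNat, simCv_eq hP hst]
  · rintro ⟨i, -, hne, hacc⟩
    refine exists_doubleOpening_or_collision (t := t) (c := c) rfl rfl ha hne hacc
      (fun k => ?_) (fun j => ?_) (fun j => ?_) (fun j => ?_) rfl fun k => ?_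
    · change Data.nth k (.vec fun k : Fin d => .num (simDec (code E) y k)) = _
      rw [Data.nth_vec, simDec_eq hP hK]
      rfl
    · change Data.nth j (.vec _) = _
      rw [Data.nth_vec, hcom]
    · change Data.nth j (.vec _) = _
      rw [Data.nth_vec, hhash]
    · change Data.nth j (.vec _) = _
      rw [Data.nth_vec]
    · change Data.nth k (.vec fun k : Fin d => .num (S.simResult t (code E) st vs k)) = _
      rw [Data.nth_vec, ha, simResult_eq hP hcontrib]

theorem dom_rounds (hP : E.P ∈ (S.lhh.setup κ).support) (hK : E.K.Valid)
    (hn : N * S.lhh.q E.P < E.K.n) (adv : Data) (t : ℕ) :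
    Dom (((3 ^ d) ^ N) ^ t) (Represents E) (rounds A κ E adv t)
      (S.simRounds A κ (code E) adv t) := by
  induction t with
  | zero =>
    rw [pow_zero]
    refine Dom.pure ⟨rfl, rfl, fun i k => ?_, ?_⟩
    · change ((Data.nth i (.vec fun _ : Fin N => .vec fun _ : Fin d => .num 0)).nth k).toNat = _
      rw [Data.nth_vec, Data.nth_vec]
      simp [Data.toNat]
    · rintro ⟨i, hi⟩
      exact hi.elim
  | succ t ih =>
    rw [pow_succ]
    exact ih.bind fun σ st hst => dom_round hP hK hn hst

end

end System

/-! ### Uniform group elements -/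

namespace GroupGen

variable {𝒢 : GroupGen} {P : Data}

theorem orderOf_g (P : Data) : orderOf (𝒢.g P) = 𝒢.q P :=
  orderOf_eq_card_of_forall_mem_zpowers (𝒢.g_gen P)

/-- As `g` has order `q`, the map `u ↦ a * g ^ u` is a bijection from `{0, …, q - 1}` onto the
group. It is used with `a = g` for bases that a reduction creates by `powData`, whose accumulator
starts at `g`, and with `a = 1` for the challenge. -/
theorem uniform_eq (a : 𝒢.G P) :
    PMF.uniformOfFintype (𝒢.G P) = (unif (𝒢.q P)).map fun u => a * 𝒢.g P ^ u := by
  classical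
  ext x
  have hr : (Finset.range (𝒢.q P)).Nonempty := ⟨0, by simpa using q_pos P⟩
  obtain ⟨u, hu, hux⟩ : ∃ u < 𝒢.q P, 𝒢.g P ^ u = a⁻¹ * x := by
    have h := 𝒢.g_gen P (a⁻¹ * x)
    rw [mem_zpowers_iff_mem_range_orderOf, orderOf_g, Finset.mem_image] at h
    obtain ⟨u, hu, h⟩ := h
    exact ⟨u, Finset.mem_range.1 hu, h⟩
  rw [PMF.map_apply, tsum_eq_single u, if_pos (by rw [hux, mul_inv_cancel_left]), unif,
    unifOn_apply hr, if_pos (Finset.mem_range.2 hu), PMF.uniformOfFintype_apply, Finset.card_range,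
    GroupGen.q, Nat.card_eq_fintype_card]
  intro v hv
  rw [unif, unifOn_apply hr]
  split_ifs with h1 h2
  · refine absurd (pow_injOn_Iio_orderOf (x := 𝒢.g P) ?_ ?_ ?_) hv
    · simpa [orderOf_g] using h2
    · simpa [orderOf_g] using hu
    · simp only [hux, h1, inv_mul_cancel_left]
  · rfl
  · rfl

/-- Bases of the hash with known logarithms. -/
theorem hashBases_eq (d : ℕ) (P : Data) : 𝒢.hashBases d P =
    (tuple fun _ : Fin d => unif (𝒢.q P)).map fun u k => 𝒢.g P * 𝒢.g P ^ u k := by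
  rw [hashBases, uniform_eq (𝒢.g P), ← tuple_map _ fun _ u => 𝒢.g P * 𝒢.g P ^ u]

/-- Bases of the hash with known logarithms, except for the base with index `k`. -/
theorem hashBases_eq_update {d : ℕ} (P : Data) (k : Fin d) : 𝒢.hashBases d P =
    (unif (𝒢.q P)).bind fun x => (tuple fun _ : Fin d => unif (𝒢.q P)).map fun u =>
      Function.update (fun l => 𝒢.g P * 𝒢.g P ^ u l) k (𝒢.g P ^ x) := by
  have h := tuple_update (fun _ : Fin d => PMF.uniformOfFintype (𝒢.G P)) k
  have h1 : (tuple fun _ : Fin d => PMF.uniformOfFintype (𝒢.G P)) =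
    (tuple fun _ : Fin d => unif (𝒢.q P)).map fun u k => 𝒢.g P * 𝒢.g P ^ u k := hashBases_eq d P
  rw [hashBases, ← h, h1, uniform_eq 1, PMF.bind_map]
  simp only [PMF.bind_map, Function.comp_def, one_mul]
  rfl

end GroupGen

namespace System

variable {N d : ℕ} (S : System N d)

/-- The logarithm of the base with index `k`, computed from a collision and the logarithms of the
other bases. -/
def solveLog (k : Fin d) (q : ℕ) (u : Fin d → ℕ) (st : Data) : ℕ :=
  (∑ l ∈ Finset.univ.erase k,
    (1 + u l) * (((st.nth 7).nth l).toNat + q - ((st.nth 1).fst.nth l).toNat)) *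
  powMod (((st.nth 1).fst.nth k).toNat + q - ((st.nth 7).nth k).toNat) (q - 2) q

variable {S}

/-- Comparing exponents of `g` gives `x (a' k - a k) = ∑ (1 + u l) (a l - a' l)` modulo the prime
`q`, summed over `l ≠ k`. The coefficient of `x` is nonzero and is inverted by Fermat's theorem, as
the power with exponent `q - 2`. -/
theorem Collision.pow_solveLog {P : Data} {k : Fin d} {x : ℕ} {u : Fin d → ℕ} {st : Data}
    (h : S.Collision (Function.update (fun l => S.lhh.g P * S.lhh.g P ^ u l) k (S.lhh.g P ^ x))
      st k) :
    S.lhh.g P ^ solveLog k (S.lhh.q P) u st = S.lhh.g P ^ x := by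
  obtain ⟨a, a', ha, ha', hne, hh⟩ := h
  have hprime : Fact (S.lhh.q P).Prime := ⟨S.lhh.prime P⟩
  have hq := S.lhh.q_pos P
  set e : Fin d → ℕ := Function.update (fun l => 1 + u l) k x with he
  have hb : (Function.update (fun l => S.lhh.g P * S.lhh.g P ^ u l) k (S.lhh.g P ^ x)) =
      fun l => S.lhh.g P ^ e l := by
    funext l
    by_cases hl : l = k
    · subst hl
      simp [he]
    · simp [he, hl, pow_add]
  have hhash : ∀ m : Fin d → ZMod (S.lhh.q P), S.lhh.hash (fun l => S.lhh.g P ^ e l) m =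
      S.lhh.g P ^ (∑ l, e l * (m l).val) := fun m => by
    simp only [GroupGen.hash, ← pow_mul, Finset.prod_pow_eq_pow_sum]
  have hcast : ∀ m n : ℕ, S.lhh.g P ^ m = S.lhh.g P ^ n ↔
      (m : ZMod (S.lhh.q P)) = (n : ZMod (S.lhh.q P)) := fun m n => by
    rw [pow_eq_pow_iff_modEq, GroupGen.orderOf_g, ZMod.natCast_eq_natCast_iff]
  rw [hb, hhash, hhash, hcast] at hh
  push_cast at hh
  simp only [ZMod.natCast_zmod_val] at hh
  rw [← Finset.add_sum_erase _ _ (Finset.mem_univ k),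
    ← Finset.add_sum_erase _ _ (Finset.mem_univ k)] at hh
  have hek : e k = x := by simp [he]
  have hel : ∀ l ∈ Finset.univ.erase k, e l = 1 + u l := fun l hl => by
    simp [he, Finset.ne_of_mem_erase hl]
  have hD : a' k - a k ≠ 0 := sub_ne_zero.2 hne
  have hlin : (x : ZMod (S.lhh.q P)) * (a' k - a k) =
      ∑ l ∈ Finset.univ.erase k, ((1 + u l : ℕ) : ZMod (S.lhh.q P)) * (a l - a' l) := by
    have e1 : ∀ m : Fin d → ZMod (S.lhh.q P),
        ∑ l ∈ Finset.univ.erase k, (e l : ZMod (S.lhh.q P)) * m l =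
        ∑ l ∈ Finset.univ.erase k, ((1 + u l : ℕ) : ZMod (S.lhh.q P)) * m l := fun m =>
      Finset.sum_congr rfl fun l hl => by rw [hel l hl]
    rw [e1, e1, hek] at hh
    simp only [mul_sub, Finset.sum_sub_distrib]
    linear_combination hh
  have hinv : (a' k - a k) ^ (S.lhh.q P - 2) * (a' k - a k) = 1 := by
    have h2 : ∀ m : ℕ, 2 ≤ m → m - 2 + 1 = m - 1 := fun m _ => by omega
    rw [← pow_succ, h2 _ (S.lhh.prime P).two_le]
    exact ZMod.pow_card_sub_one_eq_one hD
  rw [hcast, solveLog, powMod_eq hq.ne']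
  -- In `solveLog` the modulus is added before subtracting, to avoid truncation.
  have hsub : ∀ b c : ZMod (S.lhh.q P), ((b.val + S.lhh.q P - c.val : ℕ) : ZMod (S.lhh.q P)) =
      b - c := fun b c => by
    rw [Nat.cast_sub ((ZMod.val_lt c).le.trans (Nat.le_add_left _ _)), Nat.cast_add, ZMod.natCast_self, add_zero,
      ZMod.natCast_zmod_val, ZMod.natCast_zmod_val]
  rw [Nat.cast_mul, ZMod.natCast_mod, Nat.cast_pow, Nat.cast_sum]
  simp only [ha, ha', Data.toNat, Nat.cast_mul, hsub]
  rw [← hlin]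
  linear_combination (x : ZMod (S.lhh.q P)) * hinv

/-! ### The reductions -/

variable (S)

/-- The codes of bases with known logarithms. -/
def baseData (κ : ℕ) (P u : Data) : Data := S.lhh.powData κ P (P.nth 2) (P.nth 2) u.toNat

/-- The adversary against the binding property, for the commitment of the device `j`. -/
def bindAdv (A : ℕ → Data → PMF Data) (t : ℕ) (j : Fin N) (κ : ℕ) (pp : Data) : PMF Data :=
  (S.lhh.setup κ).bind fun P =>
  (tuple fun _ : Fin d => (unif (P.nth 1).toNat).map Data.num).bind fun u =>
  (S.simBody A t κ (.list [P, .vec fun k => S.baseData κ P (u k), pp])).bind fun st =>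
  PMF.pure (.list [(st.nth 3).nth j, (st.nth 4).nth j, (st.nth 5).nth j, ((st.nth 6).nth j).fst,
    ((st.nth 6).nth j).snd])

/-- The adversary against the discrete logarithm problem, for a collision at the coordinate `k`. -/
def dlogAdv (A : ℕ → Data → PMF Data) (t : ℕ) (k : Fin d) (κ : ℕ) (inp : Data) : PMF Data :=
  (tuple fun _ : Fin d => (unif ((inp.nth 0).nth 1).toNat).map Data.num).bind fun u =>
  ((S.com.gen κ).map fun o => Data.pair o.1 o.2).bind fun o =>
  (S.simBody A t κ (.list [inp.nth 0, .vec fun l => if l = k then inp.nth 1 else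
    S.baseData κ (inp.nth 0) (u l), o.snd])).bind fun st =>
  PMF.pure (.num (solveLog k ((inp.nth 0).nth 1).toNat (fun l => (u l).toNat) st))

variable {S}

theorem polyFun_baseData {P u : ℕ → Data → Data} (hP : PolyFun P) (hu : PolyFun u) :
    PolyFun fun κ x => S.baseData κ (P κ x) (u κ x) :=
  PolyFun.powData hP (hP.nth 2) (hP.nth 2) (PolyNum.toNat hu)

theorem polyNum_solveLog (k : Fin d) {q : ℕ → Data → ℕ} {u : Fin d → ℕ → Data → ℕ}
    {st : ℕ → Data → Data} (hq : PolyNum q) (hu : ∀ l, PolyNum (u l)) (hst : PolyFun st) :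
    PolyNum fun κ x => solveLog k (q κ x) (fun l => u l κ x) (st κ x) :=
  (PolyNum.sum _ fun l => ((PolyNum.const 1).add (hu l)).mul
    (((PolyNum.toNat ((hst.nth 7).nth l)).add hq).sub
      (PolyNum.toNat ((hst.nth 1).fst.nth l)))).mul
  ((((PolyNum.toNat ((hst.nth 1).fst.nth k)).add hq).sub
      (PolyNum.toNat ((hst.nth 7).nth k))).powMod (hq.sub (.const 2)) hq)

theorem isPPT_bindAdv {A : ℕ → Data → PMF Data} (hA : IsPPT A) (t : ℕ) (j : Fin N) :
    IsPPT (S.bindAdv A t j) := by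
  have id := PolyFun.id
  refine IsPPT.bind S.lhh.setup_ppt ?_
  refine IsPPT.bind_tuple (fun _ => IsPPT.unif (PolyNum.toNat (id.snd.nth 1))) ?_
  refine IsPPT.bind ((isPPT_simBody hA t).comp ?_) ?_
  · exact PolyFun.listCons id.fst.snd (PolyFun.listCons
      (PolyFun.vec fun k => polyFun_baseData id.fst.snd (id.snd.nth k))
      (PolyFun.listCons id.fst.fst .listNil))
  · exact PolyFun.listCons ((id.snd.nth 3).nth j) (PolyFun.listCons ((id.snd.nth 4).nth j)
      (PolyFun.listCons ((id.snd.nth 5).nth j) (PolyFun.listCons ((id.snd.nth 6).nth j).fst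
        (PolyFun.listCons ((id.snd.nth 6).nth j).snd .listNil))))

theorem isPPT_dlogAdv {A : ℕ → Data → PMF Data} (hA : IsPPT A) (t : ℕ) (k : Fin d) :
    IsPPT (S.dlogAdv A t k) := by
  have id := PolyFun.id
  refine IsPPT.bind_tuple (fun _ => IsPPT.unif (PolyNum.toNat ((id.nth 0).nth 1))) ?_
  refine IsPPT.bind S.com.gen_ppt ?_
  refine IsPPT.bind ((isPPT_simBody hA t).comp ?_) ?_
  · exact PolyFun.listCons (id.fst.fst.nth 0) (PolyFun.listCons
      (PolyFun.vec fun l => PolyFun.ite_prop _ (id.fst.fst.nth 1)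
        (polyFun_baseData (id.fst.fst.nth 0) (id.fst.snd.nth l)))
      (PolyFun.listCons id.snd.snd .listNil))
  · exact polyNum_solveLog k (PolyNum.toNat ((id.fst.fst.fst.nth 0).nth 1))
      (fun l => PolyNum.toNat (id.fst.fst.snd.nth l)) id.snd

/-! ### The advantage of the adversary -/

section

variable {A : ℕ → Data → PMF Data} {κ : ℕ} {P : Data}

/-- The input of the simulation. -/
def simInput (P : Data) (b : Fin d → S.lhh.G P) (pp : Data) : Data :=
  .list [P, .vec fun k => .num (S.lhh.enc P (b k)), pp]

/-- The statement that the Paillier key is unsuitable. -/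
def BadKey (S : System N d) (P : Data) (K : PaillierKey) : Prop :=
  ¬ (K.Valid ∧ N * S.lhh.q P < K.n)

theorem expect_fooled_le (hP : P ∈ (S.lhh.setup κ).support) (b : Fin d → S.lhh.G P) (pp : Data)
    (t : ℕ) (i : Fin N) :
    (expect (S.heGen κ) fun K => expect (S.dataGen κ) fun D =>
      expect (A κ (.pair (.num 0)
        (.list [P, .vec fun k => .num (S.lhh.enc P (b k)), pp, .num K.n, .num K.g]))) fun y =>
      expect (rounds A κ { P := P, b := b, pp := pp, K := K, D := D, w := y.snd } y.fst t)
        fun σ => ind (σ.fooled i)) ≤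
    expect (S.heGen κ) (fun K => ind (S.BadKey P K)) + ((3 ^ d) ^ N) ^ t *
      (∑ j, expect (S.simBody A t κ (simInput P b pp)) (fun st => ind (S.DoubleOpening P pp st j)) +
        ∑ k, expect (S.simBody A t κ (simInput P b pp)) fun st => ind (S.Collision b st k)) := by
  have hsum : expect (S.simBody A t κ (simInput P b pp)) (fun st =>
      ind ((∃ j, S.DoubleOpening P pp st j) ∨ ∃ k, S.Collision b st k)) ≤
      ∑ j, expect (S.simBody A t κ (simInput P b pp)) (fun st => ind (S.DoubleOpening P pp st j)) +
        ∑ k, expect (S.simBody A t κ (simInput P b pp)) fun st => ind (S.Collision b st k) := by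
    rw [← expect_sum, ← expect_sum, ← expect_add]
    exact expect_mono fun st => (ind_or_le _ _).trans
      (add_le_add (ind_exists_le _) (ind_exists_le _))
  refine le_trans ?_ (add_le_add le_rfl (mul_le_mul_right hsum _))
  rw [simBody, expect_bind, expect_map, ← expect_const_mul, ← expect_add]
  refine expect_mono fun K => ?_
  -- For a suitable key the simulation dominates the rounds. For any other key the probability of
  -- being fooled is bounded by `1`, which the first summand pays for.
  by_cases hK : K.Valid ∧ N * S.lhh.q P < K.n
  · refine le_trans ?_ le_add_self
    rw [expect_bind, ← expect_const_mul]
    refine expect_mono fun D => ?_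
    rw [expect_bind, ← expect_const_mul]
    refine expect_mono fun y => ?_
    exact dom_rounds (A := A) (E := { P := P, b := b, pp := pp, K := K, D := D, w := y.snd })
      hP hK.1 hK.2 y.fst t _ _ fun σ st hσ => ind_mono fun h => hσ.fooled ⟨i, h⟩
  · refine le_trans ?_ le_self_add
    rw [BadKey, ind_of hK]
    refine (expect_mono fun D => (expect_mono fun y =>
      (expect_mono fun σ => ind_le_one _).trans (expect_const _ _).le).trans
        (expect_const _ _).le).trans (expect_const _ _).le

/-- The bases that `bindAdv` makes from known logarithms are uniform, so the simulation has the
right input; `hMsg` ensures that both opened hash values are messages, as the binding experiment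
demands. -/
theorem expect_doubleOpening_le (hMsg : S.HashesAreMessages) (t : ℕ) (j : Fin N) :
    (expect (S.lhh.setup κ) fun P => expect (S.lhh.hashBases d P) fun b =>
      expect (S.com.gen κ) fun o => expect (S.simBody A t κ (simInput P b o.2)) fun st =>
        ind (S.DoubleOpening P o.2 st j)) ≤
      S.com.bindExp (S.bindAdv A t j) κ True := by
  rw [apply_true_eq]
  simp only [CommitmentScheme.bindExp, Bind.bind, expect_bind, expect_pure, bindAdv]
  -- The binding experiment draws the commitment parameters before the adversary draws the group;
  -- these independent samples are exchanged.
  simp only [expect_comm _ (S.com.gen κ)]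
  refine expect_mono_support fun o ho => expect_mono_support fun P hP => ?_
  rw [GroupGen.hashBases_eq, expect_map, tuple_map _ fun _ => Data.num, expect_map,
    GroupGen.toNat_order hP]
  refine expect_mono fun u => ?_
  have hb : ∀ k, S.baseData κ P (.num (u k)) =
      .num (S.lhh.enc P (S.lhh.g P * S.lhh.g P ^ u k)) := fun k => by
    rw [baseData, S.lhh.g_spec κ P hP, GroupGen.powData_eq hP, Data.toNat]
  simp only [hb]
  refine expect_mono fun st => ind_mono ?_
  rintro ⟨h, h', hne, h4, h6, e1, e2⟩
  change (st.nth 4).nth j ∈ S.com.msgSpace o.2 ∧ ((st.nth 6).nth j).fst ∈ S.com.msgSpace o.2 ∧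
    S.com.dec o.2 ((st.nth 3).nth j) ((st.nth 4).nth j) ((st.nth 5).nth j) ∧
    S.com.dec o.2 ((st.nth 3).nth j) ((st.nth 6).nth j).fst ((st.nth 6).nth j).snd ∧
    (st.nth 4).nth j ≠ ((st.nth 6).nth j).fst
  rw [h4, h6]
  exact ⟨hMsg κ P hP o ho h, hMsg κ P hP o ho h', e1, e2, fun e =>
    hne (S.lhh.enc_inj P (Data.num.inj e))⟩

/-- Planting the challenge `g ^ x` as the base with index `k` leaves the joint law of the bases
unchanged (`hashBases_eq_update`), so a collision at `k` occurs as often inside the reduction and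
yields the logarithm each time. -/
theorem expect_collision_le (t : ℕ) (k : Fin d) :
    (expect (S.lhh.setup κ) fun P => expect (S.lhh.hashBases d P) fun b =>
      expect (S.com.gen κ) fun o => expect (S.simBody A t κ (simInput P b o.2)) fun st =>
        ind (S.Collision b st k)) ≤
      S.lhh.dlogExp (S.dlogAdv A t k) κ True := by
  rw [apply_true_eq]
  simp only [GroupGen.dlogExp, Bind.bind, expect_bind, expect_pure, dlogAdv]
  refine expect_mono_support fun P hP => ?_
  rw [GroupGen.hashBases_eq_update P k, expect_bind]
  refine expect_mono fun x => ?_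
  change _ ≤ expect (tuple fun _ : Fin d => (unif (P.nth 1).toNat).map Data.num) _
  rw [expect_map, tuple_map _ fun _ => Data.num, expect_map, GroupGen.toNat_order hP]
  refine expect_mono fun u => ?_
  rw [expect_map]
  refine expect_mono fun o => ?_
  have hb : (fun l => if l = k then Data.num (S.lhh.enc P (S.lhh.g P ^ x)) else
      S.baseData κ P (.num (u l))) = fun l => .num (S.lhh.enc P
        (Function.update (fun l => S.lhh.g P * S.lhh.g P ^ u l) k (S.lhh.g P ^ x) l)) := by
    funext l
    rw [baseData, S.lhh.g_spec κ P hP, GroupGen.powData_eq hP, Data.toNat]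
    by_cases hl : l = k
    · subst hl
      simp
    · simp [hl]
  change _ ≤ expect (S.simBody A t κ (.list [P, .vec fun l => if l = k then
    Data.num (S.lhh.enc P (S.lhh.g P ^ x)) else S.baseData κ P (.num (u l)), o.2])) fun st =>
      ind (S.lhh.g P ^ solveLog k (P.nth 1).toNat u st = S.lhh.g P ^ x)
  rw [hb, GroupGen.toNat_order hP]
  exact expect_mono fun st => ind_mono fun h => h.pow_solveLog

theorem integrityExp_le (hMsg : S.HashesAreMessages) (t : ℕ) (i : Fin N) :
    S.integrityExp A t i κ True ≤ S.badKeyExp κ True + ((3 ^ d) ^ N) ^ t *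
      (∑ j, S.com.bindExp (S.bindAdv A t j) κ True +
        ∑ k, S.lhh.dlogExp (S.dlogAdv A t k) κ True) := by
  calc S.integrityExp A t i κ True
    _ ≤ expect (S.lhh.setup κ) fun P => expect (S.lhh.hashBases d P) fun b =>
        expect (S.com.gen κ) fun o => expect (S.heGen κ) (fun K => ind (S.BadKey P K)) +
          ((3 ^ d) ^ N) ^ t * (∑ j, expect (S.simBody A t κ (simInput P b o.2))
            (fun st => ind (S.DoubleOpening P o.2 st j)) +
          ∑ k, expect (S.simBody A t κ (simInput P b o.2)) fun st => ind (S.Collision b st k)) := by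
      rw [apply_true_eq]
      simp only [integrityExp, Bind.bind, expect_bind, expect_pure]
      exact expect_mono_support fun P hP => expect_mono fun b => expect_mono fun o =>
        expect_fooled_le hP b o.2 t i
    _ ≤ _ := by
      simp only [expect_add, expect_const_mul, expect_sum, expect_const]
      refine add_le_add ?_ (mul_le_mul_right (add_le_add (Finset.sum_le_sum fun j _ =>
        expect_doubleOpening_le hMsg t j) (Finset.sum_le_sum fun k _ =>
        expect_collision_le t k)) _)
      rw [apply_true_eq]
      simp only [badKeyExp, Bind.bind, expect_bind, expect_pure, BadKey, le_refl]

end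

theorem Pr_integrityExp_le {A : ℕ → Data → PMF Data} (hMsg : S.HashesAreMessages) (t : ℕ)
    (i : Fin N) (κ : ℕ) :
    Pr (S.integrityExp A t i κ) ≤ Pr (S.badKeyExp κ) + ((3 ^ d) ^ N) ^ t *
      (∑ j, Pr (S.com.bindExp (S.bindAdv A t j) κ) +
        ∑ k, Pr (S.lhh.dlogExp (S.dlogAdv A t k) κ)) := by
  have hfin : ∀ μ : PMF Prop, μ True ≠ ⊤ := fun μ => μ.apply_ne_top _
  have hsum : ∀ {n : ℕ} (f : Fin n → PMF Prop), ∑ j, f j True ≠ ⊤ := fun f =>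
    ENNReal.sum_ne_top.2 fun j _ => hfin _
  have h := ENNReal.toReal_mono (ENNReal.add_ne_top.2 ⟨hfin _, ENNReal.mul_ne_top (by simp)
    (ENNReal.add_ne_top.2 ⟨hsum _, hsum _⟩)⟩) (integrityExp_le (A := A) (κ := κ) hMsg t i)
  rw [ENNReal.toReal_add (hfin _) (ENNReal.mul_ne_top (by simp)
    (ENNReal.add_ne_top.2 ⟨hsum _, hsum _⟩)), ENNReal.toReal_mul,
    ENNReal.toReal_add (hsum _) (hsum _), ENNReal.toReal_sum fun j _ => hfin _,
    ENNReal.toReal_sum fun j _ => hfin _] at h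
  simpa [Pr] using h

end System

theorem Negligible.sum {n : ℕ} {f : Fin n → ℕ → ℝ} (h : ∀ i, Negligible (f i)) :
    Negligible fun κ => ∑ i, f i κ := by
  induction n with
  | zero =>
    simp only [Finset.univ_eq_empty, Finset.sum_empty]
    exact Asymptotics.superpolynomialDecay_zero Filter.atTop fun κ : ℕ => (κ : ℝ)
  | succ n ih =>
    simp only [Fin.sum_univ_succ]
    exact Asymptotics.SuperpolynomialDecay.add (h 0) (ih fun i => h i.succ)

end VerFU
end

theorem theorem1 {N d : ℕ} (S : VerFU.System N d)
    (hParam : VerFU.Negligible fun κ => VerFU.Pr (S.badKeyExp κ))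
    (hMsg : S.HashesAreMessages)
    (hDLog : S.lhh.DLogHard)
    (hBind : S.com.Binding)
    (hEqu : S.com.Equivocal) :
    S.UnlearningIntegrity := by
  intro A hA t _ i _
  -- As `N`, `d` and `t` are fixed, the number of reductions and the factor in front of them do not
  -- depend on `κ`, and the bound remains negligible.
  have hneg : VerFU.Negligible fun κ => VerFU.Pr (S.badKeyExp κ) + ((3 ^ d) ^ N) ^ t *
      (∑ j, VerFU.Pr (S.com.bindExp (S.bindAdv A t j) κ) +
        ∑ k, VerFU.Pr (S.lhh.dlogExp (S.dlogAdv A t k) κ)) :=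
    hParam.add (Asymptotics.SuperpolynomialDecay.const_mul
      ((VerFU.Negligible.sum fun j => hBind _ (VerFU.System.isPPT_bindAdv hA t j)).add
        (VerFU.Negligible.sum fun k => hDLog _ (VerFU.System.isPPT_dlogAdv hA t k))) _)
  refine hneg.trans_abs_le fun κ => ?_
  have h0 : 0 ≤ VerFU.Pr (S.integrityExp A t i κ) := ENNReal.toReal_nonneg
  rw [abs_of_nonneg h0]
  exact (VerFU.System.Pr_integrityExp_le hMsg t i κ).trans (le_abs_self _)
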